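/- \textbf{Setting.} Fix $N,T\in\mathbb N=\{1,2,\dots\}$ and Polish spaces $\mathcal X_t$, $\mathcal Y_t\neq\emptyset$, $t\in\{1,\dots,T\}$; put $\mathcal X=\prod_t\mathcal X_t$, $\mathcal Y=\prod_t\mathcal Y_t$. A filtered process with values in $\mathcal X$ is a tuple $\mathbb X=(\Omega,\mathcal F,(\mathcal F_t)_{t=1}^T,\mathbb P,X)$, where $\Omega=\Omega_1\times\dots\times\Omega_T$ is a product of Polish spaces with their Borel $\sigma$-algebras, $\mathcal F_t$ is the $\sigma$-algebra generated by the first $t$ coordinates, $\mathcal F=\mathcal F_T$, $\mathbb P$ is a probability measure on $(\Omega,\mathcal F)$, and $X=(X_t)_{t=1}^T$ is adapted with $X_t$ valued in $\mathcal X_t$; analogously for $\mathcal Y$, and $\mathrm{FP}(\mathcal Y)$ denotes the class of all filtered processes with values in $\mathcal Y$. Fix filtered processes $\mathbb X^1,\dots,\mathbb X^N$ with values in $\mathcal X$, $\mathbb X^i=(\Omega^i,\mathcal F^i,(\mathcal F^i_t)_t,\mathbb P^i,X^i)$. A probability measure on a product of such spaces $\Omega^i$ with marginals $\mathbb P^i$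 is a coupling. A coupling of $\mathbb X^1,\mathbb X^2$ is \emph{causal} if for all $t\in\{1,\dots,T\}$, $\mathcal F^1_T$ is conditionally independent of $\mathcal F^2_t$ given $\mathcal F^1_t$ (viewed as $\sigma$-algebras on the product), and \emph{bicausal} if it is causal in both directions. A coupling of finitely many processes is \emph{multicausal} if for all $t$ and $i$, $\mathcal F^i_T$ is conditionally independent of $\bigotimes_j\mathcal F^j_t$ given $\mathcal F^i_t$. Write $\mathrm{cpl}_{\rm bc}$, $\mathrm{cpl}_{\rm mc}$ for the sets of bicausal and multicausal couplings. Let $c^i_t:\mathcal X_t\times\mathcal Y_t\to\mathbb R$ be measurable and bounded from below, $c^i(x,y)=\sum_{t=1}^T c^i_t(x_t,y_t)$ for $i\in\{1,\dots,N\}$, and assume that $c(x^{1:N})=\inf_{y\in\mathcal Y}\sum_{i=1}^N c^i(x^i,y)$ is a Borel measurable function on $\mathcal X^N$. Define, with values in $(-\infty,+\infty]$, \[\mathcal{AW}_{c^i}(\mathbb X^i,\mathbb Y)=\inf_{\pi\in\mathrm{cpl}_{\rm bc}(\mathbb X^i,\mathbb Y)}\mathbb E_\pi[c^i(X^i,Y)],\quad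 B(\mathbb Y)=\sum_{i=1}^N\mathcal{AW}_{c^i}(\mathbb X^i,\mathbb Y),\quad B^{\rm bc}=\inf_{\mathbb Y\in\mathrm{FP}(\mathcal Y)}B(\mathbb Y),\] \[V^{\rm mc}_c=\inf_{\pi\in\mathrm{cpl}_{\rm mc}(\mathbb X^1,\dots,\mathbb X^N)}\mathbb E_\pi[c(X^1,\dots,X^N)].\] Let $\Phi^0$ be the set of $\phi^0=(\phi^0_t)_{t=1}^T$ with every $\phi^0_t:\mathcal X_t^N\to\mathcal Y_t$ universally measurable and \[\inf_{y_t\in\mathcal Y_t}\sum_{i=1}^N c^i_t(x^i_t,y_t)=\sum_{i=1}^N c^i_t\big(x^i_t,\phi^0_t(x_t^{1:N})\big)\quad\text{for all }x_t^{1:N}\in\mathcal X_t^N.\] \textbf{Theorem.} Under these assumptions the following hold. (1) $B^{\rm bc}=V^{\rm mc}_c$. (2) Let $\bar{\mathbb Y}$ satisfy $B(\bar{\mathbb Y})=B^{\rm bc}$, and for every $i$ let $\pi^\star_i\in\mathrm{cpl}_{\rm bc}(\mathbb X^i,\bar{\mathbb Y})$ be optimal for $\mathcal{AW}_{c^i}(\mathbb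 X^i,\bar{\mathbb Y})$. Then there exists $\mathbb Q^\star\in\mathrm{cpl}_{\rm mc}(\mathbb X^1,\dots,\mathbb X^N,\bar{\mathbb Y})$ whose marginal on $\Omega^i\times\Omega^{\bar{\mathbb Y}}$ is $\pi^\star_i$ for every $i$; and for every such $\mathbb Q^\star$, its marginal $\pi^\star$ on $\Omega^1\times\dots\times\Omega^N$ belongs to $\mathrm{cpl}_{\rm mc}(\mathbb X^1,\dots,\mathbb X^N)$ and attains $V^{\rm mc}_c$. (3) Let $\pi^\star\in\mathrm{cpl}_{\rm mc}(\mathbb X^1,\dots,\mathbb X^N)$ attain $V^{\rm mc}_c$ and let $\phi^0\in\Phi^0$. Then there are Borel maps $\phi^{0,\pi^\star}_t:\mathcal X_t^N\to\mathcal Y_t$, $t\in\{1,\dots,T\}$, with $\phi^{0,\pi^\star}_t(X^1_t,\dots,X^N_t)=\phi^0_t(X^1_t,\dots,X^N_t)$ $\pi^\star$-almost surely; and for every such choice the filtered process \[\Big(\textstyle\prod_i\Omega^i,\ \bigotimes_i\mathcal F^i_T,\ \big(\bigotimes_i\mathcal F^i_t\big)_{t=1}^T,\ \pi^\star,\ \big(\phi^{0,\pi^\star}_t(X^1_t,\dots,X^N_t)\big)_{t=1}^T\Big)\]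 attains $B^{\rm bc}$ (here $\prod_i\Omega^i$ is identified with $\prod_t\prod_i\Omega^i_t$). -/

import Mathlib

open MeasureTheory ProbabilityTheory

universe u v w

noncomputable section

namespace MulticausalOT

/-- A filtered probability space `Ω = Ω_1 × ⋯ × Ω_T`: every `Ω_t` is a Polish space with its Borel
`σ`-algebra (a standard Borel space), and `P` is a probability measure on the product. The
filtration is the canonical one, see `FilteredSpace.filt`. Time `t ∈ {1, …, T}` is the element
`t - 1` of `Fin T`. -/
structure FilteredSpace (T : ℕ) where
  Ω : Fin T → Type u
  [meas : ∀ t, MeasurableSpace (Ω t)]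
  [borel : ∀ t, StandardBorelSpace (Ω t)]
  P : Measure (∀ t, Ω t)
  [prob : IsProbabilityMeasure P]

attribute [instance] FilteredSpace.meas FilteredSpace.borel FilteredSpace.prob

/-- The space `Ω_{1:T}`. -/
abbrev FilteredSpace.Path {T : ℕ} (S : FilteredSpace.{u} T) : Type u := ∀ t, S.Ω t

/-- The canonical filtration: `S.filt t` is generated by the first `t` coordinates (it is trivial
for `t = 0` and the whole `σ`-algebra for `t = T`). -/
@[reducible]
def FilteredSpace.filt {T : ℕ} (S : FilteredSpace.{u} T) (t : ℕ) : MeasurableSpace S.Path :=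
  ⨆ s : {s : Fin T // s.val < t}, MeasurableSpace.comap (fun ω : S.Path => ω s.1) (S.meas s.1)

theorem FilteredSpace.filt_le {T : ℕ} (S : FilteredSpace.{u} T) (t : ℕ) :
    S.filt t ≤ (inferInstance : MeasurableSpace S.Path) :=
  iSup_le fun s => (measurable_pi_apply s.1).comap_le

/-- A filtered process with values in `𝒳 = 𝒳_1 × ⋯ × 𝒳_T`, adapted to the canonical filtration. -/
structure FilteredProcess (T : ℕ) (𝒳 : Fin T → Type v) [∀ t, MeasurableSpace (𝒳 t)]
    extends FilteredSpace.{u} T where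
  X : ∀ t : Fin T, (∀ s, Ω s) → 𝒳 t
  adapted : ∀ t : Fin T, Measurable[toFilteredSpace.filt (t.val + 1)] (X t)

/-- The path-valued random variable `X = (X_1, …, X_T)`. -/
def FilteredProcess.path {T : ℕ} {𝒳 : Fin T → Type v} [∀ t, MeasurableSpace (𝒳 t)]
    (X : FilteredProcess.{u} T 𝒳) (ω : X.Path) : ∀ t, 𝒳 t :=
  fun t => X.X t ω

section Couplings

variable {T : ℕ}

/-- Causality of a probability measure on `Ω¹ × Ω²`: for every `t ∈ {1, …, T}`, the `σ`-algebra
`ℱ¹_T` is conditionally independent of `ℱ²_t` given `ℱ¹_t`. -/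
def IsCausal (S₁ S₂ : FilteredSpace.{u} T) (π : ProbabilityMeasure (S₁.Path × S₂.Path)) : Prop :=
  ∀ t ∈ Finset.Icc 1 T,
    CondIndep (MeasurableSpace.comap Prod.fst (S₁.filt t))
      (MeasurableSpace.comap Prod.fst (S₁.filt T))
      (MeasurableSpace.comap Prod.snd (S₂.filt t))
      ((MeasurableSpace.comap_mono (S₁.filt_le t)).trans measurable_fst.comap_le)
      (π : Measure (S₁.Path × S₂.Path))

/-- The bicausal couplings of two filtered probability spaces. -/
def cplBc (S₁ S₂ : FilteredSpace.{u} T) : Set (ProbabilityMeasure (S₁.Path × S₂.Path)) :=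
  {π | (π : Measure (S₁.Path × S₂.Path)).map Prod.fst = S₁.P ∧
    (π : Measure (S₁.Path × S₂.Path)).map Prod.snd = S₂.P ∧
    IsCausal S₁ S₂ π ∧ IsCausal S₂ S₁ (π.map measurable_swap.aemeasurable)}

variable {ι : Type}

/-- The `σ`-algebra generated by the `i`-th coordinate of `∏ᵢ Ωⁱ` up to time `t`. -/
@[reducible]
def coordFilt (S : ι → FilteredSpace.{u} T) (i : ι) (t : ℕ) :
    MeasurableSpace (∀ i, (S i).Path) :=
  MeasurableSpace.comap (fun ω => ω i) ((S i).filt t)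

theorem coordFilt_le (S : ι → FilteredSpace.{u} T) (i : ι) (t : ℕ) :
    coordFilt S i t ≤ (inferInstance : MeasurableSpace (∀ i, (S i).Path)) :=
  (MeasurableSpace.comap_mono ((S i).filt_le t)).trans (measurable_pi_apply i).comap_le

/-- The product filtration `⨂ᵢ ℱⁱ_t` on `∏ᵢ Ωⁱ`. -/
@[reducible]
def prodFilt (S : ι → FilteredSpace.{u} T) (t : ℕ) : MeasurableSpace (∀ i, (S i).Path) :=
  ⨆ i, coordFilt S i t

variable [Fintype ι]

/-- The multicausal couplings of a finite family of filtered probability spaces: the couplings for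
which, for all `i` and all `t ∈ {1, …, T}`, `ℱⁱ_T` is conditionally independent of `⨂ⱼ ℱʲ_t`
given `ℱⁱ_t`. -/
def cplMc (S : ι → FilteredSpace.{u} T) : Set (ProbabilityMeasure (∀ i, (S i).Path)) :=
  {π | (∀ i, (π : Measure (∀ i, (S i).Path)).map (fun ω => ω i) = (S i).P) ∧
    ∀ t ∈ Finset.Icc 1 T, ∀ i,
      CondIndep (coordFilt S i t) (coordFilt S i T) (prodFilt S t) (coordFilt_le S i t)
        (π : Measure (∀ i, (S i).Path))}

/-- The family `S` with one more filtered space, indexed by `none`. -/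
abbrev adjoin (S : ι → FilteredSpace.{u} T) (S' : FilteredSpace.{u} T) :
    Option ι → FilteredSpace.{u} T
  | none => S'
  | some i => S i

/-- `Q` is a gluing of bicausal plans `πⁱ` between `Ωⁱ` and `Ω'`: it is a multicausal coupling of
all the spaces `Ωⁱ` and `Ω'`, and its marginal on `Ωⁱ × Ω'` is `πⁱ`. -/
def IsGluing (S : ι → FilteredSpace.{u} T) (S' : FilteredSpace.{u} T)
    (π : ∀ i, ProbabilityMeasure ((S i).Path × S'.Path))
    (Q : ProbabilityMeasure (∀ j, (adjoin S S' j).Path)) : Prop :=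
  Q ∈ cplMc (adjoin S S') ∧
    ∀ i, (Q : Measure (∀ j, (adjoin S S' j).Path)).map
      (fun ω => ((ω (some i), ω none) : (S i).Path × S'.Path)) = π i

/-- The marginal of `Q` on `∏ᵢ Ωⁱ`. -/
def marginalFst (S : ι → FilteredSpace.{u} T) (S' : FilteredSpace.{u} T)
    (Q : ProbabilityMeasure (∀ j, (adjoin S S' j).Path)) :
    ProbabilityMeasure (∀ i, (S i).Path) :=
  Q.map (f := fun ω i => ω (some i))
    (measurable_pi_lambda _ fun i => measurable_pi_apply (some i)).aemeasurable

/-- The space `∏ᵢ Ωⁱ`, with the probability measure `π` and with the product filtration, as a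
filtered space: its factor at time `t` is `∏ᵢ Ωⁱ_t`. -/
def prodSpace (S : ι → FilteredSpace.{u} T) (π : ProbabilityMeasure (∀ i, (S i).Path)) :
    FilteredSpace.{u} T where
  Ω t := ∀ i, (S i).Ω t
  P := (π : Measure (∀ i, (S i).Path)).map (fun ω t i => ω i t)
  prob := Measure.isProbabilityMeasure_map (Measurable.aemeasurable
    (measurable_pi_lambda _ fun t => measurable_pi_lambda _ fun i =>
      (measurable_pi_apply t).comp (measurable_pi_apply i)))

end Couplings

/-- The expectation of a measurable function, as an extended real number: the integral of the
positive part minus the integral of the negative part. It is used for functions that are bounded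
from below, and is then finite or `+∞`. -/
def expect {α : Type*} [MeasurableSpace α] (μ : Measure α) (f : α → ℝ) : EReal :=
  ((∫⁻ a, ENNReal.ofReal (f a) ∂μ : ENNReal) : EReal) -
    ((∫⁻ a, ENNReal.ofReal (-f a) ∂μ : ENNReal) : EReal)

section Problems

variable {T N : ℕ} {𝒳 : Fin T → Type v} {𝒴 : Fin T → Type w}
  [∀ t, MeasurableSpace (𝒳 t)] [∀ t, MeasurableSpace (𝒴 t)]

/-- The bicausal transport cost `𝔼_π[c(X, Y)]`. -/
def bcCost (c : (∀ t, 𝒳 t) → (∀ t, 𝒴 t) → ℝ) (X : FilteredProcess.{u} T 𝒳)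
    (Y : FilteredProcess.{u} T 𝒴) (π : ProbabilityMeasure (X.Path × Y.Path)) : EReal :=
  expect (π : Measure (X.Path × Y.Path)) (fun ω => c (X.path ω.1) (Y.path ω.2))

/-- The bicausal transport value `𝒜𝒲_c(𝕏, 𝕐)`. -/
def bcValue (c : (∀ t, 𝒳 t) → (∀ t, 𝒴 t) → ℝ) (X : FilteredProcess.{u} T 𝒳)
    (Y : FilteredProcess.{u} T 𝒴) : EReal :=
  ⨅ π ∈ cplBc X.toFilteredSpace Y.toFilteredSpace, bcCost c X Y π

/-- The barycenter functional `B(𝕐) = ∑ᵢ 𝒜𝒲_{cⁱ}(𝕏ⁱ, 𝕐)`. -/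
def baryFunctional (c : Fin N → (∀ t, 𝒳 t) → (∀ t, 𝒴 t) → ℝ)
    (X : Fin N → FilteredProcess.{u} T 𝒳) (Y : FilteredProcess.{u} T 𝒴) : EReal :=
  ∑ i, bcValue (c i) (X i) Y

/-- The bicausal barycenter value: the infimum of `B(𝕐)` over all filtered processes `𝕐` with
values in `𝒴`. -/
def baryValue (c : Fin N → (∀ t, 𝒳 t) → (∀ t, 𝒴 t) → ℝ)
    (X : Fin N → FilteredProcess.{u} T 𝒳) : EReal :=
  ⨅ Y : FilteredProcess.{u} T 𝒴, baryFunctional c X Y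

/-- The multicausal transport cost `𝔼_π[c(X¹, …, Xᴺ)]`. -/
def mcCost (c : (Fin N → ∀ t, 𝒳 t) → ℝ) (X : Fin N → FilteredProcess.{u} T 𝒳)
    (π : ProbabilityMeasure (∀ i, (X i).Path)) : EReal :=
  expect (π : Measure (∀ i, (X i).Path)) (fun ω => c fun i => (X i).path (ω i))

/-- The multicausal transport value. -/
def mcValue (c : (Fin N → ∀ t, 𝒳 t) → ℝ) (X : Fin N → FilteredProcess.{u} T 𝒳) : EReal :=
  ⨅ π ∈ cplMc (fun i => (X i).toFilteredSpace), mcCost c X π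

/-- The time-separable cost `c(x, y) = ∑_t c_t(x_t, y_t)`. -/
def sepCost (c : ∀ t, 𝒳 t → 𝒴 t → ℝ) (x : ∀ t, 𝒳 t) (y : ∀ t, 𝒴 t) : ℝ :=
  ∑ t, c t (x t) (y t)

/-- The multimarginal cost `c(x^{1:N}) = inf_y ∑ᵢ cⁱ(xⁱ, y)`. -/
def infCost (c : Fin N → (∀ t, 𝒳 t) → (∀ t, 𝒴 t) → ℝ) (x : Fin N → ∀ t, 𝒳 t) : ℝ :=
  ⨅ y : ∀ t, 𝒴 t, ∑ i, c i (x i) y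

/-- Universal measurability: measurability with respect to the completion of every probability
measure. -/
def UniversallyMeasurable {α β : Type*} [MeasurableSpace α] [MeasurableSpace β]
    (f : α → β) : Prop :=
  ∀ μ : Measure α, IsProbabilityMeasure μ → NullMeasurable f μ

/-- The set `Φ⁰` of pointwise minimizers: `φ = (φ_t)_t` with every `φ_t : 𝒳_tᴺ → 𝒴_t` universally
measurable, and `φ_t(x^{1:N})` a minimizer of `∑ᵢ cⁱ_t(xⁱ, ·)` for every `x^{1:N}`. -/
def minimizers (c : Fin N → ∀ t, 𝒳 t → 𝒴 t → ℝ) : Set (∀ t, (Fin N → 𝒳 t) → 𝒴 t) :=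
  {φ | ∀ t, UniversallyMeasurable (φ t) ∧
    ∀ x : Fin N → 𝒳 t, ⨅ y, ∑ i, c i t (x i) y = ∑ i, c i t (x i) (φ t x)}

/-- `ψ` is a Borel version of `φ` under `π`: every `ψ_t` is Borel measurable, and
`ψ_t(X¹_t, …, Xᴺ_t) = φ_t(X¹_t, …, Xᴺ_t)` holds `π`-almost surely. -/
def IsBorelVersion (X : Fin N → FilteredProcess.{u} T 𝒳)
    (π : ProbabilityMeasure (∀ i, (X i).Path)) (φ ψ : ∀ t, (Fin N → 𝒳 t) → 𝒴 t) : Prop :=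
  ∀ t, Measurable (ψ t) ∧
    ∀ᵐ ω ∂(π : Measure (∀ i, (X i).Path)),
      ψ t (fun i => (X i).X t (ω i)) = φ t (fun i => (X i).X t (ω i))

/-- The filtered process `(∏ᵢ Ωⁱ, ⨂ᵢ 𝔽ⁱ, π, (ψ_t(X¹_t, …, Xᴺ_t))_t)`. -/
def inducedProcess (X : Fin N → FilteredProcess.{u} T 𝒳)
    (π : ProbabilityMeasure (∀ i, (X i).Path)) (ψ : ∀ t, (Fin N → 𝒳 t) → 𝒴 t)
    (hψ : ∀ t, Measurable (ψ t)) : FilteredProcess.{u} T 𝒴 where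
  toFilteredSpace := prodSpace (fun i => (X i).toFilteredSpace) π
  X t ω := ψ t (fun i => (X i).X t (fun s => ω s i))
  adapted t := by
    refine (hψ t).comp ?_
    refine @measurable_pi_lambda _ _ _ (_) _ _ fun i => ?_
    refine ((X i).adapted t).comp ?_
    rw [measurable_iff_comap_le]
    unfold FilteredSpace.filt
    rw [MeasurableSpace.comap_iSup]
    refine iSup_le fun s => ?_
    refine le_trans ?_ (le_iSup _ s)
    rw [MeasurableSpace.comap_comp, ← measurable_iff_comap_le]
    exact (measurable_pi_apply i).comp (comap_measurable _)

end Problems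

end MulticausalOT

end

open MulticausalOT

/-! For every y the cost `infCost` at (x¹, …, xᴺ) is at most ∑ᵢ cⁱ(xⁱ, y), with near equality for a
suitable y. Integrating this against the right couplings gives both inequalities between the two
values.

From a process 𝕐 to a multicausal coupling: given bicausal plans πⁱ, make the paths of the 𝕏ⁱ
conditionally independent given the path of 𝕐. Causality from 𝕐 to 𝕏ᵏ makes the conditional law of
the past of 𝕏ᵏ a function of the past of 𝕐 alone. Causality from 𝕏ⁱ to 𝕐 then shows that the joint
past says no more about the future of 𝕏ⁱ than its own past does. So the gluing is multicausal
(`exists_mem_cplMc_map_eq`), and so is its marginal without 𝕐.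

From a multicausal coupling π to a process: under π the product space is itself a filtered space,
coupled to each 𝕏ⁱ by ω ↦ (ωⁱ, ω). One causality is multicausality, the other is trivial
(`map_transpose_mem_cplBc`). Since the costs are separable, the infimum over y splits over time
(`infCost_sepCost`). A near-minimizer at time t can thus be a function of the values at time t only,
which keeps the new process adapted. Borel near-minimizers come from `exists_measurable_ae_mem`; a
null exceptional set does no harm. With optimal plans or exact minimizers the same two chains of
inequalities give the statements on optimizers. -/

noncomputable section

namespace MulticausalOT

/-! ### Measurable selection up to null sets -/

section

open Set Filter Topology

/-- The Baire space embeds continuously into the real line. -/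
theorem exists_continuous_injective_baire_real :
    ∃ e : (ℕ → ℕ) → ℝ, Continuous e ∧ Function.Injective e := by
  -- The graph of σ is coded as a 0-1 sequence. Each digit depends on one coordinate of σ, hence is
  -- continuous, and the Cantor function with ratio 1/3 is injective on such sequences.
  let b : (ℕ → ℕ) → ℕ → Bool := fun σ n => decide (σ n.unpair.1 = n.unpair.2)
  refine ⟨fun σ => Cardinal.cantorFunction (1 / 3) (b σ), ?_, ?_⟩
  · refine continuous_tsum (u := fun n => (1 / 3 : ℝ) ^ n) (fun n => ?_)
      (summable_geometric_of_lt_one (by norm_num) (by norm_num)) (fun n σ => ?_)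
    · have h : Continuous fun v : ℕ =>
          (cond (decide (v = n.unpair.2)) ((1 / 3 : ℝ) ^ n) 0 : ℝ) := continuous_of_discreteTopology
      exact h.comp (continuous_apply n.unpair.1)
    · rw [Real.norm_of_nonneg (Cardinal.cantorFunctionAux_nonneg (by norm_num))]
      rcases h : b σ n with _ | _
      · rw [Cardinal.cantorFunctionAux_false h]; positivity
      · rw [Cardinal.cantorFunctionAux_true h]
  · intro σ τ h
    have hb : b σ = b τ := Cardinal.cantorFunction_injective (by norm_num) (by norm_num) h
    funext i
    have := congrFun hb (Nat.pair i (τ i))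
    simpa [b] using this

/-- A continuous map on a compact subset of the Baire space has a Borel right inverse on the
image. -/
theorem exists_measurable_rightInverse_of_isCompact {α : Type*} [TopologicalSpace α] [T2Space α]
    [MeasurableSpace α] [BorelSpace α] {h : (ℕ → ℕ) → α} (hh : Continuous h)
    {K : Set (ℕ → ℕ)} (hK : IsCompact K) :
    ∃ s : α → (ℕ → ℕ), Measurable s ∧ ∀ x ∈ h '' K, h (s x) = x := by
  classical
  obtain ⟨e, he, hinj⟩ := exists_continuous_injective_baire_real
  have hemb : MeasurableEmbedding e := he.measurableEmbedding hinj
  -- `e` orders the Baire space: the selected preimage is the `e`-least point of the compact fibre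
  -- in `K`.
  have hmem : ∀ x, x ∈ h '' K → ∃ σ ∈ K, h σ = x ∧ ∀ τ ∈ K, h τ = x → e σ ≤ e τ := by
    rintro x ⟨σ₀, hσ₀, hx⟩
    obtain ⟨σ, hσ, hmin⟩ := (hK.inter_right ((isClosed_singleton (x := x)).preimage hh)).exists_isMinOn
      ⟨σ₀, hσ₀, hx⟩ he.continuousOn
    exact ⟨σ, hσ.1, hσ.2, fun τ hτ hτx => hmin ⟨hτ, hτx⟩⟩
  choose! s hsK hsx hsmin using hmem
  have hKm : MeasurableSet (h '' K) := (hK.image hh).isClosed.measurableSet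
  refine ⟨fun x => if x ∈ h '' K then s x else 0, ?_, fun x hx => ?_⟩
  · have hr : Measurable fun x => if x ∈ h '' K then e (s x) else e 0 := by
      refine measurable_of_Iic fun a => ?_
      -- Minimality makes the sublevel sets of `e ∘ s` on the image of `K` images of compact sets,
      -- hence closed.
      have hc : MeasurableSet (h '' (K ∩ e ⁻¹' Iic a)) :=
        ((hK.inter_right (isClosed_Iic.preimage he)).image hh).isClosed.measurableSet
      have : (fun x => if x ∈ h '' K then e (s x) else e 0) ⁻¹' Iic a =
          h '' (K ∩ e ⁻¹' Iic a) ∪ ((h '' K)ᶜ ∩ {_x | e 0 ≤ a}) := by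
        ext x
        by_cases hx : x ∈ h '' K
        · simp only [mem_preimage, hx, if_true, mem_Iic, mem_union, mem_inter_iff, mem_compl_iff,
            not_true_eq_false, false_and, or_false]
          constructor
          · exact fun hle => ⟨s x, ⟨hsK x hx, hle⟩, hsx x hx⟩
          · rintro ⟨τ, ⟨hτ, hle⟩, rfl⟩
            exact (hsmin _ hx τ hτ rfl).trans hle
        · have hx' : x ∉ h '' (K ∩ e ⁻¹' Iic a) := fun hx' => hx (image_mono inter_subset_left hx')
          rw [mem_preimage, if_neg hx, mem_union, mem_inter_iff, mem_compl_iff]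
          simp only [hx', hx, not_false_eq_true, true_and, false_or, mem_Iic]
          rfl
      rw [this]
      exact hc.union (hKm.compl.inter (MeasurableSet.const _))
    rw [← hemb.measurable_comp_iff]
    convert hr using 2 with x
    simp only [Function.comp]
    split_ifs <;> rfl
  · simp only [hx, if_true]
    exact hsx x hx

/-- Compact boxes of the Baire space carry almost all of the mass of the image. -/
theorem exists_isCompact_lt_measure_image {α : Type*} [TopologicalSpace α] [T2Space α]
    [MeasurableSpace α] [BorelSpace α] (μ : Measure α) [μ.OuterRegular]
    {h : (ℕ → ℕ) → α} (hh : Continuous h) {r : ENNReal} (hr : r < μ (range h)) :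
    ∃ K : Set (ℕ → ℕ), IsCompact K ∧ r ≤ μ (h '' K) := by
  -- Boxes bounding the first `m` coordinates only. Continuity from below lets the bounds be chosen
  -- one at a time with the measure of the image staying above `r`.
  let B : ℕ → (ℕ → ℕ) → Set (ℕ → ℕ) := fun m n => {σ | ∀ i < m, σ i ≤ n i}
  have hstep : ∀ m n, r < μ (h '' B m n) →
      ∃ k, r < μ (h '' B (m + 1) (Function.update n m k)) := by
    intro m n hlt
    have hU : h '' B m n = ⋃ k, h '' B (m + 1) (Function.update n m k) := by
      rw [← image_iUnion]
      congr 1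
      ext σ
      simp only [B, mem_ofPred_eq, mem_iUnion]
      constructor
      · intro hσ
        refine ⟨σ m, fun i hi => ?_⟩
        rcases Nat.lt_succ_iff_lt_or_eq.1 hi with hi | rfl
        · simpa [Function.update_of_ne hi.ne] using hσ i hi
        · simp
      · rintro ⟨k, hk⟩ i hi
        simpa [Function.update_of_ne hi.ne] using hk i (hi.trans (Nat.lt_succ_self m))
    have hmono : Monotone fun k => h '' B (m + 1) (Function.update n m k) := by
      intro k l hkl
      refine image_mono fun σ hσ i hi => (hσ i hi).trans ?_
      rcases eq_or_ne i m with rfl | hne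
      · simpa using hkl
      · simp [Function.update_of_ne hne]
    rw [hU, hmono.measure_iUnion] at hlt
    exact lt_iSup_iff.1 hlt
  choose! k hk using hstep
  let N : ℕ → (ℕ → ℕ) := fun m => Nat.rec 0 (fun m n => Function.update n m (k m n)) m
  have hN : ∀ m, r < μ (h '' B m (N m)) := by
    intro m
    induction m with
    | zero => simpa [B, image_univ] using hr
    | succ m ih => exact hk m (N m) ih
  have hNs : ∀ m, N (m + 1) = Function.update (N m) m (k m (N m)) := fun _ => rfl
  have hNle : ∀ i m, i < m → N m i = N (i + 1) i := by
    intro i m him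
    induction m, him using Nat.le_induction with
    | base => rfl
    | succ m hm ih => rw [hNs m, Function.update_of_ne (by omega), ih]
  -- The bound on coordinate `i` is set at stage `i + 1` and never changed afterwards.
  let n : ℕ → ℕ := fun i => N (i + 1) i
  have hBN : ∀ m, B m (N m) = B m n := by
    intro m
    ext σ
    exact forall₂_congr fun i hi => by rw [hNle i m hi]
  have hK : IsCompact (Set.univ.pi fun i => Iic (n i)) :=
    isCompact_univ_pi fun i => (finite_Iic (n i)).isCompact
  refine ⟨_, hK, ?_⟩
  -- The images of the boxes need not be measurable, so no continuity from above is used. By outer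
  -- regularity it is enough that every open set containing the image of the compact box contains
  -- the image of some `B m n`.
  rw [Set.measure_eq_iInf_isOpen]
  refine le_iInf₂ fun U hU => le_iInf fun hUo => ?_
  have hV : IsOpen (h ⁻¹' U) := hUo.preimage hh
  have hcyl : ∀ σ ∈ Set.univ.pi (fun i => Iic (n i)), ∃ m, PiNat.cylinder σ m ⊆ h ⁻¹' U := by
    intro σ hσ
    obtain ⟨v, ⟨τ, m, rfl⟩, hσv, hv⟩ :=
      (PiNat.isTopologicalBasis_cylinders (fun _ : ℕ => ℕ)).exists_subset_of_mem_open
        (show σ ∈ h ⁻¹' U from hU (mem_image_of_mem h hσ)) hV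
    exact ⟨m, by rwa [PiNat.mem_cylinder_iff_eq.1 hσv]⟩
  choose! m hm using hcyl
  obtain ⟨t, htK, ht⟩ := hK.elim_nhds_subcover (fun σ => PiNat.cylinder σ (m σ)) fun σ _ =>
    (PiNat.isOpen_cylinder (fun _ : ℕ => ℕ) σ (m σ)).mem_nhds (PiNat.self_mem_cylinder σ _)
  have hsub : B (t.sup m) n ⊆ h ⁻¹' U := by
    intro τ hτ
    -- Truncating `τ` by `n` lands in the compact box without changing the first coordinates, so `τ`
    -- lies in the same cylinder.
    have hτ' : (fun i => min (τ i) (n i)) ∈ Set.univ.pi fun i => Iic (n i) :=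
      fun i _ => mem_Iic.2 (min_le_right _ _)
    obtain ⟨σ, hσt, hσ⟩ := mem_iUnion₂.1 (ht hτ')
    refine hm σ (htK σ hσt) fun i hi => ?_
    rw [← hσ i hi]
    exact (min_eq_left (hτ i (hi.trans_le (Finset.le_sup hσt)))).symm
  calc r ≤ μ (h '' B (t.sup m) n) := by rw [← hBN]; exact (hN _).le
    _ ≤ μ U := measure_mono (image_subset_iff.2 hsub)

/-- A continuous surjection from the Baire space has a Borel right inverse almost everywhere. -/
theorem exists_measurable_ae_rightInverse {α : Type*} [TopologicalSpace α] [PolishSpace α]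
    [MeasurableSpace α] [BorelSpace α] (μ : Measure α) [IsFiniteMeasure μ]
    {h : (ℕ → ℕ) → α} (hh : Continuous h) (hsurj : Function.Surjective h) :
    ∃ s : α → (ℕ → ℕ), Measurable s ∧ ∀ᵐ x ∂μ, h (s x) = x := by
  classical
  have hex : ∀ q : ℕ, ∃ K : Set (ℕ → ℕ), IsCompact K ∧
      μ univ - ((q : ENNReal) + 1)⁻¹ ≤ μ (h '' K) := by
    intro q
    by_cases h0 : μ univ = 0
    · exact ⟨∅, isCompact_empty, by simp [h0]⟩
    · refine exists_isCompact_lt_measure_image μ hh ?_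
      rw [hsurj.range_eq]
      exact ENNReal.sub_lt_self (measure_ne_top _ _) h0 (by simp)
  choose K hK hμ using hex
  choose s hs hsx using fun q => exists_measurable_rightInverse_of_isCompact hh (hK q)
  have hKm : ∀ q, MeasurableSet (h '' K q) := fun q => ((hK q).image hh).isClosed.measurableSet
  have hU : MeasurableSet (⋃ q, h '' K q) := MeasurableSet.iUnion hKm
  -- The second alternative makes the search for an index succeed at the points that no compact
  -- image covers.
  let p : ℕ → α → Prop := fun q x => x ∈ h '' K q ∨ x ∉ ⋃ q, h '' K q
  have hp : ∀ x, ∃ q, p q x := by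
    intro x
    by_cases hx : x ∈ ⋃ q, h '' K q
    · obtain ⟨q, hq⟩ := mem_iUnion.1 hx
      exact ⟨q, Or.inl hq⟩
    · exact ⟨0, Or.inr hx⟩
  refine ⟨fun x => s (Nat.find (hp x)) x,
    Measurable.find (p := p) hs (fun q => (hKm q).union hU.compl) hp, ?_⟩
  have hnull : μ (⋃ q, h '' K q)ᶜ = 0 := by
    rw [measure_compl hU (measure_ne_top _ _), tsub_eq_zero_iff_le]
    refine ENNReal.le_of_forall_pos_le_add fun ε hε _ => ?_
    obtain ⟨q, hq⟩ := ENNReal.exists_inv_nat_lt (a := (ε : ENNReal)) (by simpa using hε.ne')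
    have h1 : μ univ - ((q : ENNReal) + 1)⁻¹ ≤ μ (⋃ q, h '' K q) :=
      (hμ q).trans (measure_mono (subset_iUnion (fun q => h '' K q) q))
    refine (tsub_le_iff_right.1 h1).trans ?_
    gcongr
    exact (ENNReal.inv_le_inv.2 le_self_add).trans hq.le
  filter_upwards [compl_mem_ae_iff.2 hnull] with x hx
  have hx' : x ∈ ⋃ q, h '' K q := by simpa using hx
  exact hsx _ x ((Nat.find_spec (hp x)).resolve_right (not_not.2 hx'))

/-- **Measurable selection.** A Borel set with nonempty sections contains the graph of a Borel
function, up to a null set. -/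
theorem exists_measurable_ae_mem {α β : Type*} [MeasurableSpace α] [StandardBorelSpace α]
    [MeasurableSpace β] [StandardBorelSpace β] [Nonempty β] (μ : Measure α) [IsFiniteMeasure μ]
    {D : Set (α × β)} (hD : MeasurableSet D) (hsec : ∀ x, ∃ y, (x, y) ∈ D) :
    ∃ f : α → β, Measurable f ∧ ∀ᵐ x ∂μ, (x, f x) ∈ D := by
  let := upgradeStandardBorel α
  let := upgradeStandardBorel β
  have hA : AnalyticSet D := hD.analyticSet
  rw [AnalyticSet] at hA
  rcases hA with rfl | ⟨g, hg, rfl⟩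
  · refine ⟨fun _ => Classical.arbitrary β, measurable_const, ae_of_all _ fun x => ?_⟩
    obtain ⟨y, hy⟩ := hsec x
    exact hy.elim
  -- `D` is the image of the Baire space under `g`. Nonempty sections make the first component of
  -- `g` surjective; a right inverse of it followed by the second component is the selection.
  · have hsurj : Function.Surjective fun σ => (g σ).1 := by
      intro x
      obtain ⟨y, σ, hσ⟩ := hsec x
      exact ⟨σ, by simp [hσ]⟩
    obtain ⟨s, hs, hsx⟩ := exists_measurable_ae_rightInverse μ (continuous_fst.comp hg) hsurj
    refine ⟨fun x => (g (s x)).2, (continuous_snd.comp hg).measurable.comp hs, ?_⟩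
    filter_upwards [hsx] with x hx
    exact ⟨s x, Prod.ext hx rfl⟩

end

/-! ### Conditional independence through conditional probabilities -/

section

open Set

section CondIndep

variable {Ω : Type*}

/-- If `μ (A ∩ B) = ∫⁻ ω in B, a ω ∂μ` holds on a generating `π`-system, then it holds on the
generated `σ`-algebra. -/
theorem measure_inter_eq_setLIntegral_of_generateFrom {m m₀ : MeasurableSpace Ω} (hm : m ≤ m₀)
    {μ : Measure Ω} [IsFiniteMeasure μ] {A : Set Ω} {a : Ω → ENNReal} {C : Set (Set Ω)}
    (hgen : m = MeasurableSpace.generateFrom C) (hpi : IsPiSystem C)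
    (huniv : μ A = ∫⁻ ω, a ω ∂μ) (h : ∀ B ∈ C, μ (A ∩ B) = ∫⁻ ω in B, a ω ∂μ)
    {B : Set Ω} (hB : MeasurableSet[m] B) : μ (A ∩ B) = ∫⁻ ω in B, a ω ∂μ := by
  have h1 : ∀ B, MeasurableSet[m] B → (μ.restrict A).trim hm B = μ (A ∩ B) := by
    intro B hB
    rw [trim_measurableSet_eq hm hB, Measure.restrict_apply (hm _ hB), inter_comm]
  have h2 : ∀ B, MeasurableSet[m] B → (μ.withDensity a).trim hm B = ∫⁻ ω in B, a ω ∂μ := by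
    intro B hB
    rw [trim_measurableSet_eq hm hB, withDensity_apply _ (hm _ hB)]
  rw [← h1 B hB, ← h2 B hB]
  congr 1
  have hC : ∀ s ∈ C, MeasurableSet[m] s := fun s hs => hgen ▸ MeasurableSpace.measurableSet_generateFrom hs
  refine @ext_of_generate_finite Ω m _ _ C hgen hpi inferInstance (fun s hs => ?_) ?_
  · rw [h1 s (hC s hs), h2 s (hC s hs), h s hs]
  · rw [h1 _ MeasurableSet.univ, h2 _ MeasurableSet.univ]
    simpa using huniv

variable {m' m₁ m₂ m₃ : MeasurableSpace Ω} {mΩ : MeasurableSpace Ω} [StandardBorelSpace Ω]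
  {μ : Measure Ω} [IsFiniteMeasure μ]

/-- Under conditional independence of `m₁` and `m₂` given `m'`, the conditional probability of a
set of `m₁` given `m' ⊔ m₂` has an `m'`-measurable version. -/
theorem CondIndep.exists_lintegral_eq {hm' : m' ≤ mΩ} (h : CondIndep m' m₁ m₂ hm' μ)
    (hm₁ : m₁ ≤ mΩ) (hm₂ : m₂ ≤ mΩ) {A : Set Ω} (hA : MeasurableSet[m₁] A) :
    ∃ a : Ω → ENNReal, Measurable[m'] a ∧
      (∀ B, MeasurableSet[m' ⊔ m₂] B → μ (A ∩ B) = ∫⁻ ω in B, a ω ∂μ) ∧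
      ∀ g : Ω → ENNReal, Measurable[m' ⊔ m₂] g →
        ∫⁻ ω in A, g ω ∂μ = ∫⁻ ω, a ω * g ω ∂μ := by
  have hsup : m' ⊔ m₂ ≤ mΩ := sup_le hm' hm₂
  let f : Ω → ℝ := μ⟦A | m'⟧
  have hf : StronglyMeasurable[m'] f := stronglyMeasurable_condExp
  have hfi : Integrable f μ := integrable_condExp
  have hf0 : 0 ≤ᵐ[μ] f := condExp_nonneg (ae_of_all _ fun ω => indicator_nonneg (by simp) ω)
  let a : Ω → ENNReal := fun ω => ENNReal.ofReal (f ω)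
  have ha : Measurable[m'] a := ENNReal.measurable_ofReal.comp hf.measurable
  -- Conditional independence factors the conditional probability of `A ∩ B`, and pulling out the
  -- factor `f` gives the identity on rectangles, a generating π-system.
  have hrect : ∀ C B, MeasurableSet[m'] C → MeasurableSet[m₂] B →
      μ (A ∩ (C ∩ B)) = ∫⁻ ω in C ∩ B, a ω ∂μ := by
    intro C B hC hB
    have hBm : MeasurableSet B := hm₂ _ hB
    have hCm : MeasurableSet C := hm' _ hC
    have hAm : MeasurableSet A := hm₁ _ hA
    have hint : ∀ s : Set Ω, MeasurableSet s → Integrable (s.indicator fun _ => (1 : ℝ)) μ :=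
      fun s hs => (integrable_const 1).indicator hs
    have hfB : Integrable (f * B.indicator fun _ => (1 : ℝ)) μ := by
      have : (f * B.indicator fun _ => (1 : ℝ)) = B.indicator f := by
        ext ω; by_cases hω : ω ∈ B <;> simp [hω]
      rw [this]
      exact hfi.indicator hBm
    have hkey : ∫ ω in C, (A ∩ B).indicator (fun _ => (1 : ℝ)) ω ∂μ = ∫ ω in C ∩ B, f ω ∂μ := by
      calc ∫ ω in C, (A ∩ B).indicator (fun _ => (1 : ℝ)) ω ∂μ
          = ∫ ω in C, (μ⟦A ∩ B | m'⟧) ω ∂μ :=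
            (setIntegral_condExp hm' (hint _ (hAm.inter hBm)) hC).symm
        _ = ∫ ω in C, (μ[f * B.indicator fun _ => (1 : ℝ) | m']) ω ∂μ := by
            refine setIntegral_congr_ae hCm ?_
            filter_upwards [(condIndep_iff m' m₁ m₂ hm' hm₁ hm₂ μ).1 h A B hA hB,
              condExp_mul_of_stronglyMeasurable_left hf hfB (hint B hBm)] with ω h1 h2 _
            rw [h1, h2]
        _ = ∫ ω in C, (f * B.indicator fun _ => (1 : ℝ)) ω ∂μ := setIntegral_condExp hm' hfB hC
        _ = ∫ ω in C, B.indicator f ω ∂μ := by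
            congr 1; ext ω; by_cases hω : ω ∈ B <;> simp [hω]
        _ = ∫ ω in C ∩ B, f ω ∂μ := setIntegral_indicator hBm
    rw [← ofReal_integral_eq_lintegral_ofReal hfi.integrableOn (ae_restrict_of_ae hf0), ← hkey,
      setIntegral_indicator (hAm.inter hBm)]
    simp only [setIntegral_const, smul_eq_mul, mul_one, Measure.real]
    rw [ENNReal.ofReal_toReal (measure_ne_top _ _)]
    congr 1
    ext ω
    simp only [mem_inter_iff]
    tauto
  have hset : ∀ B, MeasurableSet[m' ⊔ m₂] B → μ (A ∩ B) = ∫⁻ ω in B, a ω ∂μ := by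
    intro B hB
    refine measure_inter_eq_setLIntegral_of_generateFrom hsup
      (C := {s | ∃ u v, MeasurableSet[m'] u ∧ MeasurableSet[m₂] v ∧ s = u ∩ v}) ?_ ?_ ?_ ?_ hB
    · refine le_antisymm (sup_le ?_ ?_) (MeasurableSpace.generateFrom_le ?_)
      · exact fun s hs => MeasurableSpace.measurableSet_generateFrom
          ⟨s, univ, hs, MeasurableSet.univ, by simp⟩
      · exact fun s hs => MeasurableSpace.measurableSet_generateFrom
          ⟨univ, s, MeasurableSet.univ, hs, by simp⟩
      · rintro s ⟨u, v, hu, hv, rfl⟩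
        exact MeasurableSet.inter ((le_sup_left : m' ≤ m' ⊔ m₂) _ hu)
          ((le_sup_right : m₂ ≤ m' ⊔ m₂) _ hv)
    · rintro _ ⟨u, v, hu, hv, rfl⟩ _ ⟨u', v', hu', hv', rfl⟩ _
      exact ⟨u ∩ u', v ∩ v', hu.inter hu', hv.inter hv', inter_inter_inter_comm _ _ _ _⟩
    · simpa using hrect univ univ MeasurableSet.univ MeasurableSet.univ
    · rintro _ ⟨u, v, hu, hv, rfl⟩
      exact hrect u v hu hv
  refine ⟨a, ha, hset, fun g hg => ?_⟩
  -- On `m' ⊔ m₂` the restriction of `μ` to `A` has density `a`, so integrals of measurable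
  -- functions agree as well.
  have htrim : (μ.restrict A).trim hsup = (μ.withDensity a).trim hsup := by
    refine @Measure.ext _ (m' ⊔ m₂) _ _ fun B hB => ?_
    rw [trim_measurableSet_eq hsup hB, trim_measurableSet_eq hsup hB,
      withDensity_apply _ (hsup _ hB), Measure.restrict_apply (hsup _ hB), inter_comm, hset B hB]
  rw [← lintegral_trim hsup hg, htrim, lintegral_trim hsup hg,
    lintegral_withDensity_eq_lintegral_mul _ (ha.mono hm' le_rfl) (hg.mono hsup le_rfl)]
  rfl

/-- A criterion for conditional independence: the conditional probabilities of the sets of `m₁`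
given a `σ`-algebra that contains `m'` and `m₂` are `m'`-measurable. -/
theorem condIndep_of_forall_exists (hm₁ : m₁ ≤ mΩ) (hm₃ : m₃ ≤ mΩ)
    (h'₃ : m' ≤ m₃) (h₂₃ : m₂ ≤ m₃)
    (h : ∀ A, MeasurableSet[m₁] A → ∃ a : Ω → ENNReal, Measurable[m'] a ∧
      ∀ B, MeasurableSet[m₃] B → μ (A ∩ B) = ∫⁻ ω in B, a ω ∂μ) :
    CondIndep m' m₁ m₂ (h'₃.trans hm₃) μ := by
  have hm' : m' ≤ mΩ := h'₃.trans hm₃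
  have hm₂ : m₂ ≤ mΩ := h₂₃.trans hm₃
  rw [condIndep_iff m' m₁ m₂ hm' hm₁ hm₂ μ]
  intro A B hA hB
  obtain ⟨a, ha, hab⟩ := h A hA
  have hAm := hm₁ _ hA
  have hBm := hm₂ _ hB
  have hint : ∀ s : Set Ω, MeasurableSet s → Integrable (s.indicator fun _ => (1 : ℝ)) μ :=
    fun s hs => (integrable_const 1).indicator hs
  have hafin : ∫⁻ ω, a ω ∂μ ≠ ⊤ := by
    have := hab univ MeasurableSet.univ
    rw [inter_univ, Measure.restrict_univ] at this
    exact this ▸ measure_ne_top μ A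
  have ham : Measurable a := ha.mono hm' le_rfl
  let f : Ω → ℝ := fun ω => (a ω).toReal
  have hf : StronglyMeasurable[m'] f := (ENNReal.measurable_toReal.comp ha).stronglyMeasurable
  have hfi : Integrable f μ := integrable_toReal_of_lintegral_ne_top ham.aemeasurable hafin
  have hset : ∀ B, MeasurableSet[m₃] B → ∫ ω in B, f ω ∂μ = μ.real (A ∩ B) := by
    intro B hB
    rw [Measure.real, hab B hB, ← integral_toReal ham.aemeasurable.restrict]
    exact ae_restrict_of_ae (ae_lt_top ham hafin)
  have hone : ∀ s t : Set Ω, MeasurableSet t →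
      ∫ ω in s, t.indicator (fun _ => (1 : ℝ)) ω ∂μ = μ.real (s ∩ t) := by
    intro s t ht
    rw [setIntegral_indicator ht]
    simp
  -- A conditional probability given `m₃` that happens to be `m'`-measurable is also the one given
  -- `m'`.
  have hfA : f =ᵐ[μ] μ⟦A | m'⟧ := by
    refine ae_eq_condExp_of_forall_setIntegral_eq hm' (hint A hAm) (fun _ _ _ => hfi.integrableOn)
      (fun s hs _ => ?_) hf.aestronglyMeasurable
    rw [hset s (h'₃ _ hs), hone s A hAm, inter_comm]
  have hfBeq : (f * B.indicator fun _ => (1 : ℝ)) = B.indicator f := by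
    ext ω; by_cases hω : ω ∈ B <;> simp [hω]
  have hfB : Integrable (f * B.indicator fun _ => (1 : ℝ)) μ := hfBeq ▸ hfi.indicator hBm
  have hpull := condExp_mul_of_stronglyMeasurable_left hf hfB (hint B hBm)
  have hAB : μ[f * B.indicator fun _ => (1 : ℝ) | m'] =ᵐ[μ] μ⟦A ∩ B | m'⟧ := by
    refine ae_eq_condExp_of_forall_setIntegral_eq hm' (hint _ (hAm.inter hBm))
      (fun _ _ _ => integrable_condExp.integrableOn) (fun s hs _ => ?_)
      stronglyMeasurable_condExp.aestronglyMeasurable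
    rw [setIntegral_condExp hm' hfB hs, hfBeq, setIntegral_indicator hBm,
      hset _ (MeasurableSet.inter (h'₃ _ hs) (h₂₃ _ hB)), hone s _ (hAm.inter hBm)]
    congr 1
    ext ω
    simp only [mem_inter_iff]
    tauto
  filter_upwards [hfA, hpull, hAB] with ω h1 h2 h3
  rw [← h3, h2, Pi.mul_apply, Pi.mul_apply, h1]

/-- Conditional independence is inherited by image measures. -/
theorem condIndep_map {Ω' : Type*} {n' n₁ n₂ : MeasurableSpace Ω'} {mΩ' : MeasurableSpace Ω'}
    [StandardBorelSpace Ω'] {f : Ω → Ω'} (hf : Measurable f) (hn' : n' ≤ mΩ') (hn₁ : n₁ ≤ mΩ')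
    (hn₂ : n₂ ≤ mΩ')
    (h : CondIndep (n'.comap f) (n₁.comap f) (n₂.comap f)
      ((MeasurableSpace.comap_mono hn').trans hf.comap_le) μ) :
    CondIndep n' n₁ n₂ hn' (μ.map f) := by
  have hsup : n' ⊔ n₂ ≤ mΩ' := sup_le hn' hn₂
  refine condIndep_of_forall_exists (m₃ := n' ⊔ n₂) hn₁ hsup le_sup_left le_sup_right
    fun A hA => ?_
  obtain ⟨a, ha, haB, -⟩ := CondIndep.exists_lintegral_eq h
    ((MeasurableSpace.comap_mono hn₁).trans hf.comap_le)
    ((MeasurableSpace.comap_mono hn₂).trans hf.comap_le) ⟨A, hA, rfl⟩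
  -- Doob–Dynkin: a function measurable for the pullback factors through `f`.
  obtain ⟨b, hb, rfl⟩ := @Measurable.exists_eq_measurable_comp _ _ _ n' f a _ _ _ ha
  refine ⟨b, hb, fun B hB => ?_⟩
  have hBm := hsup _ hB
  have hBf : MeasurableSet[n'.comap f ⊔ n₂.comap f] (f ⁻¹' B) := by
    rw [← MeasurableSpace.comap_sup]
    exact ⟨B, hB, rfl⟩
  rw [setLIntegral_map hBm (hb.mono hn' le_rfl) hf, Measure.map_apply hf ((hn₁ _ hA).inter hBm)]
  exact haB _ hBf

/-- Everything is conditionally independent of what is known. -/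
theorem condIndep_of_le (hm' : m' ≤ mΩ) (hm₁ : m₁ ≤ mΩ) (h : m₂ ≤ m') :
    CondIndep m' m₁ m₂ hm' μ :=
  (condIndep_of_condIndep_of_le_right
    (condIndep_of_forall_exists (m₂ := m') hm₁ hm' le_rfl le_rfl fun A hA => by
      obtain ⟨a, ha, haB, -⟩ := CondIndep.exists_lintegral_eq
        (condIndep_bot_right (m' := m') (hm' := hm') (μ := μ) m₁) hm₁ bot_le hA
      exact ⟨a, ha, fun B hB => haB B ((le_sup_left : m' ≤ m' ⊔ ⊥) _ hB)⟩) h)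

end CondIndep

end

/-! ### Conditionally independent gluing of kernels -/

section

open Set

section Glue

/-- The product of finitely many Markov kernels with the same source. -/
def piKernel {ι α : Type*} [Fintype ι] {β : ι → Type*} [MeasurableSpace α]
    [∀ i, MeasurableSpace (β i)] (κ : ∀ i, Kernel α (β i)) [∀ i, IsMarkovKernel (κ i)] :
    Kernel α (∀ i, β i) where
  toFun a := Measure.pi fun i => κ i a
  measurable' := by
    refine Measurable.measure_of_isPiSystem_of_isProbabilityMeasure generateFrom_pi.symm
      isPiSystem_pi ?_
    rintro _ ⟨s, hs, rfl⟩
    simp only [Measure.pi_pi]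
    exact Finset.measurable_prod _ fun i _ => Kernel.measurable_coe (κ i) (hs i (mem_univ i))

instance {ι α : Type*} [Fintype ι] {β : ι → Type*} [MeasurableSpace α]
    [∀ i, MeasurableSpace (β i)] (κ : ∀ i, Kernel α (β i)) [∀ i, IsMarkovKernel (κ i)] :
    IsMarkovKernel (piKernel κ) :=
  ⟨fun a => inferInstanceAs (IsProbabilityMeasure (Measure.pi fun i => κ i a))⟩

variable {ι : Type*} {E : Option ι → Type*} [∀ j, MeasurableSpace (E j)]

/-- A point of the product over `Option ι` from its components. -/
def optionMk (p : E none × ∀ i, E (some i)) : ∀ j, E j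
  | none => p.1
  | some i => p.2 i

theorem measurable_optionMk : Measurable (optionMk (E := E)) := by
  refine measurable_pi_lambda _ fun j => ?_
  cases j with
  | none => exact measurable_fst
  | some i => exact (measurable_pi_apply i).comp measurable_snd

variable [Fintype ι] (P : Measure (E none)) [IsProbabilityMeasure P] (κ : ∀ i, Kernel (E none) (E (some i)))
  [∀ i, IsMarkovKernel (κ i)]

/-- The law under which the coordinates are conditionally independent given the coordinate `none`,
with conditional laws `κ i`. -/
def glue : Measure (∀ j, E j) := (P ⊗ₘ piKernel κ).map optionMk

instance : IsProbabilityMeasure (glue P κ) :=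
  Measure.isProbabilityMeasure_map measurable_optionMk.aemeasurable

variable {G : ∀ j, Set (E j)}

theorem glue_pi (hG : ∀ j, MeasurableSet (G j)) :
    glue P κ (univ.pi G) = ∫⁻ y in G none, ∏ i, κ i y (G (some i)) ∂P := by
  have hpre : optionMk ⁻¹' univ.pi G = G none ×ˢ univ.pi fun i => G (some i) := by
    ext p
    simp only [mem_preimage, mem_univ_pi, mem_prod]
    exact ⟨fun h => ⟨h none, fun i => h (some i)⟩, fun h j => by
      cases j with
      | none => exact h.1
      | some i => exact h.2 i⟩
  have h2 : MeasurableSet (univ.pi fun i => G (some i)) :=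
    MeasurableSet.univ_pi fun i => hG (some i)
  rw [glue, Measure.map_apply measurable_optionMk (MeasurableSet.univ_pi hG), hpre]
  have := Measure.setLIntegral_compProd (μ := P) (κ := piKernel κ) (f := 1) measurable_one
    (hG none) h2
  simp only [Pi.one_apply, setLIntegral_one] at this
  rw [this]
  refine lintegral_congr fun y => ?_
  exact Measure.pi_pi _ _

/-- Integrating out the other coordinates over a rectangle leaves their kernel masses as a density
on `E none`. -/
theorem lintegral_glue_none (hG : ∀ j, MeasurableSet (G j)) {F : E none → ENNReal}
    (hF : Measurable F) :
    ∫⁻ ω in univ.pi G, F (ω none) ∂glue P κ =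
      ∫⁻ y in G none, F y * ∏ i, κ i y (G (some i)) ∂P := by
  classical
  have hw : Measurable fun y => ∏ i, κ i y (G (some i)) :=
    Finset.measurable_prod _ fun i _ => Kernel.measurable_coe (κ i) (hG (some i))
  have hev : Measurable fun ω : ∀ j, E j => ω none := measurable_pi_apply none
  have hmeas : ((glue P κ).restrict (univ.pi G)).map (fun ω => ω none) =
      (P.restrict (G none)).withDensity fun y => ∏ i, κ i y (G (some i)) := by
    ext s hs
    rw [Measure.map_apply hev hs, Measure.restrict_apply (hev hs), withDensity_apply _ hs,
      Measure.restrict_restrict hs]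
    have : (fun ω : ∀ j, E j => ω none) ⁻¹' s ∩ univ.pi G =
        univ.pi (Function.update G none (s ∩ G none)) := by
      ext ω
      simp only [mem_inter_iff, mem_preimage, mem_univ_pi]
      constructor
      · rintro ⟨h1, h2⟩ j
        cases j with
        | none => simpa using ⟨h1, h2 none⟩
        | some i => simpa using h2 (some i)
      · intro h
        have h0 : ω none ∈ s ∩ G none := by simpa using h none
        refine ⟨h0.1, fun j => ?_⟩
        cases j with
        | none => exact h0.2
        | some i => simpa using h (some i)
    rw [this, glue_pi]
    · simp
    · intro j
      cases j with
      | none => simpa using hs.inter (hG none)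
      | some i => simpa using hG (some i)
  rw [← lintegral_map hF hev, hmeas, lintegral_withDensity_eq_lintegral_mul _ hw hF]
  simp only [Pi.mul_apply, mul_comm]

/-- The coordinates `none` and `some i` have joint law `P ⊗ₘ κ i`; the remaining kernels only
contribute a weight that depends on the `none` coordinate. -/
theorem lintegral_glue_some [DecidableEq ι] (hG : ∀ j, MeasurableSet (G j)) (i : ι)
    {F : E (some i) → ENNReal} (hF : Measurable F) :
    ∫⁻ ω in univ.pi G, F (ω (some i)) ∂glue P κ =
      ∫⁻ p in G none ×ˢ G (some i),
        F p.2 * ∏ k ∈ Finset.univ.erase i, κ k p.1 (G (some k)) ∂(P ⊗ₘ κ i) := by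
  have hw0 : Measurable fun y => ∏ k ∈ Finset.univ.erase i, κ k y (G (some k)) :=
    Finset.measurable_prod _ fun k _ => Kernel.measurable_coe (κ k) (hG (some k))
  have hw : Measurable fun p : E none × E (some i) =>
      ∏ k ∈ Finset.univ.erase i, κ k p.1 (G (some k)) := hw0.comp measurable_fst
  have hev : Measurable fun ω : ∀ j, E j => ω (some i) := measurable_pi_apply (some i)
  have hmeas : ((glue P κ).restrict (univ.pi G)).map (fun ω => ω (some i)) =
      (((P ⊗ₘ κ i).restrict (G none ×ˢ G (some i))).withDensity fun p =>
        ∏ k ∈ Finset.univ.erase i, κ k p.1 (G (some k))).map Prod.snd := by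
    ext s hs
    have hsG : MeasurableSet (s ∩ G (some i)) := hs.inter (hG (some i))
    rw [Measure.map_apply hev hs, Measure.restrict_apply (hev hs),
      Measure.map_apply measurable_snd hs, withDensity_apply _ (measurable_snd hs),
      Measure.restrict_restrict (measurable_snd hs)]
    have h1 : (fun ω : ∀ j, E j => ω (some i)) ⁻¹' s ∩ univ.pi G =
        univ.pi (Function.update G (some i) (s ∩ G (some i))) := by
      ext ω
      simp only [mem_inter_iff, mem_preimage, mem_univ_pi]
      constructor
      · rintro ⟨h1, h2⟩ j
        rcases eq_or_ne j (some i) with rfl | hj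
        · simpa using ⟨h1, h2 (some i)⟩
        · simpa [Function.update_of_ne hj] using h2 j
      · intro h
        have h0 : ω (some i) ∈ s ∩ G (some i) := by simpa using h (some i)
        refine ⟨h0.1, fun j => ?_⟩
        rcases eq_or_ne j (some i) with rfl | hj
        · exact h0.2
        · simpa [Function.update_of_ne hj] using h j
    have h2 : (Prod.snd ⁻¹' s ∩ G none ×ˢ G (some i) : Set (E none × E (some i))) =
        G none ×ˢ (s ∩ G (some i)) := by
      ext p
      simp only [mem_inter_iff, mem_preimage, mem_prod]
      tauto
    rw [h1, h2, glue_pi, Measure.setLIntegral_compProd hw (hG none) hsG]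
    · simp only [lintegral_const, Measure.restrict_apply MeasurableSet.univ, univ_inter, ne_eq,
        reduceCtorEq, not_false_eq_true, Function.update_of_ne]
      refine lintegral_congr fun y => ?_
      rw [← Finset.prod_erase_mul _ _ (Finset.mem_univ i), Function.update_self]
      congr 1
      refine Finset.prod_congr rfl fun k hk => ?_
      rw [Function.update_of_ne (by simpa using Finset.ne_of_mem_erase hk)]
    · intro j
      rcases eq_or_ne j (some i) with rfl | hj
      · simpa using hsG
      · simpa [Function.update_of_ne hj] using hG j
  rw [← lintegral_map hF hev, hmeas, lintegral_map hF measurable_snd,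
    lintegral_withDensity_eq_lintegral_mul _ hw
      (g := fun p => F p.2) (hF.comp measurable_snd)]
  simp only [Pi.mul_apply, mul_comm]

theorem map_glue_none_some (i : ι) :
    (glue P κ).map (fun ω => (ω none, ω (some i))) = P ⊗ₘ κ i := by
  classical
  have hev : Measurable fun ω : ∀ j, E j => (ω none, ω (some i)) :=
    (measurable_pi_apply none).prodMk (measurable_pi_apply (some i))
  have := Measure.isProbabilityMeasure_map (μ := glue P κ) hev.aemeasurable
  refine ext_of_generate_finite _ generateFrom_prod.symm isPiSystem_prod ?_ (by simp)
  rintro _ ⟨s, hs, t, ht, rfl⟩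
  let G : ∀ j, Set (E j) := Function.update (Function.update (fun _ => univ) none s) (some i) t
  have hG : ∀ j, MeasurableSet (G j) := by
    intro j
    rcases eq_or_ne j (some i) with rfl | hj
    · simpa [G] using ht
    · simp only [G, Function.update_of_ne hj]
      cases j with
      | none => simpa using hs
      | some k => simp
  have hpre : (fun ω : ∀ j, E j => (ω none, ω (some i))) ⁻¹' s ×ˢ t = univ.pi G := by
    ext ω
    simp only [mem_preimage, mem_prod, mem_univ_pi]
    constructor
    · rintro ⟨h1, h2⟩ j
      rcases eq_or_ne j (some i) with rfl | hj
      · simpa [G] using h2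
      · simp only [G, Function.update_of_ne hj]
        cases j with
        | none => simpa using h1
        | some k => simp
    · exact fun h => ⟨by simpa [G] using h none, by simpa [G] using h (some i)⟩
  have hone := Measure.setLIntegral_compProd (μ := P) (κ := κ i) (f := 1) measurable_one hs ht
  simp only [Pi.one_apply, setLIntegral_one] at hone
  rw [Measure.map_apply hev (hs.prod ht), hpre, glue_pi P κ hG, hone]
  have h0 : G none = s := by simp [G]
  rw [h0]
  refine lintegral_congr fun y => ?_
  rw [Finset.prod_eq_single i (fun k _ hk => ?_) (by simp)]
  · simp [G]
  · simp [G, Function.update_of_ne, hk]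

end Glue

end

/-! ### Gluing bicausal couplings to a multicausal one -/

section

open Set

variable {T : ℕ}

theorem FilteredSpace.filt_top (S : FilteredSpace.{u} T) :
    S.filt T = (inferInstance : MeasurableSpace S.Path) :=
  le_antisymm (S.filt_le T) (iSup_le fun s =>
    le_iSup (fun s : {s : Fin T // s.val < T} =>
      MeasurableSpace.comap (fun ω : S.Path => ω s.1) (S.meas s.1)) ⟨s, s.2⟩)

theorem prodFilt_le {ι : Type} (S : ι → FilteredSpace.{u} T) (t : ℕ) :
    prodFilt S t ≤ (inferInstance : MeasurableSpace (∀ i, (S i).Path)) :=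
  iSup_le fun i => coordFilt_le S i t

theorem prodFilt_eq_generateFrom {ι : Type} [Fintype ι] (S : ι → FilteredSpace.{u} T) (t : ℕ) :
    prodFilt S t = MeasurableSpace.generateFrom
      (univ.pi '' univ.pi fun i => {s : Set (S i).Path | MeasurableSet[(S i).filt t] s}) :=
  (@generateFrom_pi ι (fun i => (S i).Path) _ fun i => (S i).filt t).symm

section Causal

variable {S₁ S₂ : FilteredSpace.{u} T} {ρ : ProbabilityMeasure (S₁.Path × S₂.Path)}

/-- Under a causal coupling, the conditional law of the second path up to time `t` given the first
path only depends on the first path up to time `t`. -/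
theorem IsCausal.exists_ae_eq_kernel (h : IsCausal S₁ S₂ ρ) {κ : Kernel S₁.Path S₂.Path}
    [IsMarkovKernel κ] (hκ : S₁.P ⊗ₘ κ = ρ) {t : ℕ} (ht : t ∈ Finset.Icc 1 T) {G : Set S₂.Path}
    (hG : MeasurableSet[S₂.filt t] G) :
    ∃ b : S₁.Path → ENNReal, Measurable[S₁.filt t] b ∧ (fun x => κ x G) =ᵐ[S₁.P] b := by
  have hGm := S₂.filt_le t _ hG
  -- Read symmetrically, causality says that the probability of `G` given the whole first path is
  -- already measurable for its past; by uniqueness it is the kernel mass.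
  obtain ⟨a, ha, haB, -⟩ := CondIndep.exists_lintegral_eq (h t ht).symm
    ((MeasurableSpace.comap_mono (S₂.filt_le t)).trans measurable_snd.comap_le)
    ((MeasurableSpace.comap_mono (S₁.filt_le T)).trans measurable_fst.comap_le) ⟨G, hG, rfl⟩
  obtain ⟨b, hb, rfl⟩ := @Measurable.exists_eq_measurable_comp _ _ _ (S₁.filt t) Prod.fst a _ _ _ ha
  have hbm : Measurable b := hb.mono (S₁.filt_le t) le_rfl
  refine ⟨b, hb, ae_eq_of_forall_setLIntegral_eq_of_sigmaFinite (Kernel.measurable_coe κ hGm) hbm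
    fun s hs _ => ?_⟩
  have hfst : (ρ : Measure (S₁.Path × S₂.Path)).map Prod.fst = S₁.P := by
    rw [← hκ]; exact Measure.fst_compProd _ _
  have := haB (Prod.fst ⁻¹' s) ((le_sup_right : MeasurableSpace.comap Prod.fst (S₁.filt T) ≤ _) _
    ⟨s, by rw [S₁.filt_top]; exact hs, rfl⟩)
  have h1 : (Prod.snd ⁻¹' G ∩ Prod.fst ⁻¹' s : Set (S₁.Path × S₂.Path)) = s ×ˢ G := by
    ext p; simp [and_comm]
  have hone := Measure.setLIntegral_compProd (μ := S₁.P) (κ := κ) (f := 1) measurable_one hs hGm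
  simp only [Pi.one_apply, setLIntegral_one] at hone
  rw [← hone, hκ, ← h1, this]
  simp only [Function.comp]
  rw [← setLIntegral_map hs hbm measurable_fst, hfst]

/-- The test function may see both pasts while the conditional probability sees only the first one.
The gluing applies this to weights produced by the second path. -/
theorem IsCausal.exists_lintegral_eq (h : IsCausal S₁ S₂ ρ) {t : ℕ} (ht : t ∈ Finset.Icc 1 T)
    {A : Set S₁.Path} (hA : MeasurableSet A) :
    ∃ b : S₁.Path → ENNReal, Measurable[S₁.filt t] b ∧ ∀ g : S₁.Path × S₂.Path → ENNReal,
      Measurable[MeasurableSpace.comap Prod.fst (S₁.filt t) ⊔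
        MeasurableSpace.comap Prod.snd (S₂.filt t)] g →
      ∫⁻ p in Prod.fst ⁻¹' A, g p ∂(ρ : Measure (S₁.Path × S₂.Path)) =
        ∫⁻ p, b p.1 * g p ∂(ρ : Measure (S₁.Path × S₂.Path)) := by
  obtain ⟨a, ha, -, hag⟩ := CondIndep.exists_lintegral_eq (h t ht)
    ((MeasurableSpace.comap_mono (S₁.filt_le T)).trans measurable_fst.comap_le)
    ((MeasurableSpace.comap_mono (S₂.filt_le t)).trans measurable_snd.comap_le)
    (A := Prod.fst ⁻¹' A) ⟨A, by rw [S₁.filt_top]; exact hA, rfl⟩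
  obtain ⟨b, hb, rfl⟩ := @Measurable.exists_eq_measurable_comp _ _ _ (S₁.filt t) Prod.fst a _ _ _ ha
  exact ⟨b, hb, hag⟩

end Causal

/-- Bicausal couplings with a common second space can be glued to a multicausal coupling. -/
theorem exists_mem_cplMc_map_eq {ι : Type} [Fintype ι] (S : Option ι → FilteredSpace.{u} T)
    (π : ∀ i, ProbabilityMeasure ((S (some i)).Path × (S none).Path))
    (hπ : ∀ i, π i ∈ cplBc (S (some i)) (S none)) :
    ∃ Q : ProbabilityMeasure (∀ j, (S j).Path), Q ∈ cplMc S ∧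
      ∀ i, (Q : Measure (∀ j, (S j).Path)).map (fun ω => (ω (some i), ω none)) = π i := by
  classical
  have hne : ∀ j, Nonempty (S j).Path := fun j => nonempty_of_isProbabilityMeasure (S j).P
  let P : Measure (S none).Path := (S none).P
  let ρ : ∀ i, ProbabilityMeasure ((S none).Path × (S (some i)).Path) := fun i =>
    (π i).map measurable_swap.aemeasurable
  have hρ : ∀ i, (ρ i : Measure ((S none).Path × (S (some i)).Path)) =
      (π i : Measure ((S (some i)).Path × (S none).Path)).map Prod.swap := fun i => rfl
  have hρfst : ∀ i, (ρ i : Measure ((S none).Path × (S (some i)).Path)).fst = P := by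
    intro i
    rw [hρ, Measure.fst, Measure.map_map measurable_fst measurable_swap]
    exact (hπ i).2.1
  -- Each plan is disintegrated along the common space, hence the swap.
  let κ : ∀ i, Kernel (S none).Path (S (some i)).Path := fun i =>
    (ρ i : Measure ((S none).Path × (S (some i)).Path)).condKernel
  have hκ : ∀ i, P ⊗ₘ κ i = ρ i := by
    intro i
    rw [← hρfst i]
    exact Measure.disintegrate _ _
  have hswap : ∀ i, (P ⊗ₘ κ i).map Prod.swap = π i := by
    intro i
    rw [hκ, hρ, Measure.map_map measurable_swap measurable_swap, Prod.swap_swap_eq, Measure.map_id]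
  let Q : ProbabilityMeasure (∀ j, (S j).Path) :=
    ⟨glue (E := fun j => (S j).Path) P κ, inferInstance⟩
  have hQ : (Q : Measure (∀ j, (S j).Path)) = glue (E := fun j => (S j).Path) P κ := rfl
  have hQi : ∀ i, (Q : Measure (∀ j, (S j).Path)).map (fun ω => (ω (some i), ω none)) = π i := by
    intro i
    rw [← hswap i, ← map_glue_none_some (E := fun j => (S j).Path) P κ i]
    exact (Measure.map_map measurable_swap
      ((measurable_pi_apply none).prodMk (measurable_pi_apply (some i)))).symm
  have hQnone : (Q : Measure (∀ j, (S j).Path)).map (fun ω => ω none) = P := by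
    ext s hs
    have h := lintegral_glue_none (E := fun j => (S j).Path) P κ (G := fun _ => univ)
      (fun _ => MeasurableSet.univ) (F := s.indicator 1) (measurable_one.indicator hs)
    rw [pi_univ] at h
    simp only [Measure.restrict_univ, measure_univ, Finset.prod_const_one, mul_one,
      lintegral_indicator_one hs] at h
    rw [← h, hQ, ← lintegral_indicator_one hs,
      lintegral_map (measurable_one.indicator hs) (measurable_pi_apply none)]
  refine ⟨Q, ⟨fun j => ?_, fun t ht j => ?_⟩, hQi⟩
  · cases j with
    | none => exact hQnone
    | some i =>
      rw [← (hπ i).1, ← hQi i]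
      exact (Measure.map_map measurable_fst
        ((measurable_pi_apply (some i)).prodMk (measurable_pi_apply none))).symm
  have hfac : ∀ G : ∀ j, Set (S j).Path, (∀ j, MeasurableSet[(S j).filt t] (G j)) → ∀ i,
      ∃ b : (S none).Path → ENNReal, Measurable[(S none).filt t] b ∧
        (fun y => κ i y (G (some i))) =ᵐ[P] b := fun G hG i =>
    IsCausal.exists_ae_eq_kernel (hπ i).2.2.2 (hκ i) ht (hG (some i))
  -- Rectangles of past events generate the product past, so it suffices to test the conditional
  -- probability of `A` on them.
  suffices hA : ∀ A : Set (S j).Path, MeasurableSet A → ∃ a : (S j).Path → ENNReal,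
      Measurable[(S j).filt t] a ∧ ∀ G : ∀ j, Set (S j).Path,
        (∀ j, MeasurableSet[(S j).filt t] (G j)) →
        ∫⁻ ω in univ.pi G, A.indicator 1 (ω j) ∂(Q : Measure (∀ j, (S j).Path)) =
          ∫⁻ ω in univ.pi G, a (ω j) ∂(Q : Measure (∀ j, (S j).Path)) by
    refine condIndep_of_forall_exists (coordFilt_le S j T) (prodFilt_le S t)
      (le_iSup (fun j => coordFilt S j t) j) le_rfl ?_
    rintro _ ⟨A, hAT, rfl⟩
    have hAm : MeasurableSet A := (S j).filt_le T _ hAT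
    obtain ⟨a, ha, haG⟩ := hA A hAm
    have hrect : ∀ G : ∀ j, Set (S j).Path, (∀ j, MeasurableSet[(S j).filt t] (G j)) →
        (Q : Measure (∀ j, (S j).Path)) ((fun ω => ω j) ⁻¹' A ∩ univ.pi G) =
          ∫⁻ ω in univ.pi G, a (ω j) ∂(Q : Measure (∀ j, (S j).Path)) := by
      intro G hG
      rw [← haG G hG, ← Measure.restrict_apply (measurable_pi_apply j hAm),
        ← lintegral_indicator_one (measurable_pi_apply j hAm)]
      rfl
    refine ⟨fun ω => a (ω j), ha.comp (comap_measurable _), fun B hB => ?_⟩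
    refine measure_inter_eq_setLIntegral_of_generateFrom (prodFilt_le S t)
      (prodFilt_eq_generateFrom S t) (@isPiSystem_pi _ _ fun j => (S j).filt t) ?_ ?_ hB
    · simpa using hrect (fun _ => univ) fun _ => MeasurableSet.univ
    · rintro _ ⟨G, hG, rfl⟩
      exact hrect G fun j => hG j (mem_univ j)
  intro A hA
  cases j with
  | none =>
    -- Independence from `⊥` is automatic: `a` is just the probability of `A` given the past. The
    -- weight left by the other kernels is past-measurable, so it can be used as a test function.
    obtain ⟨a, ha, -, hag⟩ := CondIndep.exists_lintegral_eq
      (condIndep_bot_right (m' := (S none).filt t) (hm' := (S none).filt_le t) (μ := P)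
        inferInstance) le_rfl bot_le hA
    refine ⟨a, ha, fun G hG => ?_⟩
    have hGm : ∀ j, MeasurableSet (G j) := fun j => (S j).filt_le t _ (hG j)
    choose b hb hκb using hfac G hG
    have hprod : (fun y => ∏ i, κ i y (G (some i))) =ᵐ[P] fun y => ∏ i, b i y := by
      filter_upwards [ae_all_iff.2 hκb] with y hy
      exact Finset.prod_congr rfl fun i _ => hy i
    have hF : ∀ F : (S none).Path → ENNReal, Measurable F →
        ∫⁻ ω in univ.pi G, F (ω none) ∂(Q : Measure (∀ j, (S j).Path)) =
          ∫⁻ y, F y * (G none).indicator (fun y => ∏ i, b i y) y ∂P := by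
      intro F hF
      rw [hQ, lintegral_glue_none (E := fun j => (S j).Path) P κ hGm hF,
        ← lintegral_indicator (hGm none)]
      refine lintegral_congr_ae ?_
      filter_upwards [hprod] with y hy
      by_cases hyG : y ∈ G none
      · simp only [indicator_of_mem hyG, hy]
      · simp [indicator_of_notMem hyG]
    rw [hF _ (measurable_one.indicator hA), hF _ (ha.mono ((S none).filt_le t) le_rfl), ← hag,
      ← lintegral_indicator hA]
    · refine lintegral_congr fun y => ?_
      by_cases hyA : y ∈ A <;> simp [hyA]
    · exact ((Finset.measurable_prod _ fun i _ => hb i).indicator (hG none)).mono le_sup_left le_rfl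
  | some i =>
    obtain ⟨a, ha, hag⟩ := IsCausal.exists_lintegral_eq (hπ i).2.2.1 ht hA
    refine ⟨a, ha, fun G hG => ?_⟩
    have hGm : ∀ j, MeasurableSet (G j) := fun j => (S j).filt_le t _ (hG j)
    choose b hb hκb using hfac G hG
    -- All other spaces enter through this weight. With `b k` in place of the kernel masses it is
    -- measurable for the joint past of the pair, so causality from `S (some i)` to `S none`
    -- applies.
    let w : (S (some i)).Path × (S none).Path → ENNReal := fun p =>
      (G (some i)).indicator 1 p.1 *
        (G none).indicator (fun y => ∏ k ∈ Finset.univ.erase i, b k y) p.2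
    have hw1 : Measurable[(S (some i)).filt t] ((G (some i)).indicator (1 : (S (some i)).Path → ENNReal)) :=
      Measurable.indicator (m := (S (some i)).filt t) (f := 1) measurable_const (hG (some i))
    have hw2 : Measurable[(S none).filt t]
        ((G none).indicator (fun y => ∏ k ∈ Finset.univ.erase i, b k y)) :=
      (Finset.measurable_prod _ fun k _ => hb k).indicator (hG none)
    have hw : Measurable[MeasurableSpace.comap Prod.fst ((S (some i)).filt t) ⊔
        MeasurableSpace.comap Prod.snd ((S none).filt t)] w :=
      ((hw1.comp (comap_measurable _)).mono le_sup_left le_rfl).mul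
        ((hw2.comp (comap_measurable _)).mono le_sup_right le_rfl)
    have hwm : Measurable w := ((hw1.mono ((S (some i)).filt_le t) le_rfl).comp measurable_fst).mul
      ((hw2.mono ((S none).filt_le t) le_rfl).comp measurable_snd)
    have hprod : ∀ᵐ p ∂(P ⊗ₘ κ i), ∏ k ∈ Finset.univ.erase i, κ k p.1 (G (some k)) =
        ∏ k ∈ Finset.univ.erase i, b k p.1 := by
      have h1 : ∀ᵐ y ∂P, ∀ k, κ k y (G (some k)) = b k y := ae_all_iff.2 hκb
      rw [← Measure.fst_compProd P (κ i)] at h1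
      filter_upwards [ae_of_ae_map measurable_fst.aemeasurable h1] with p hp
      exact Finset.prod_congr rfl fun k _ => hp k
    have hF : ∀ F : (S (some i)).Path → ENNReal, Measurable F →
        ∫⁻ ω in univ.pi G, F (ω (some i)) ∂(Q : Measure (∀ j, (S j).Path)) =
          ∫⁻ p, F p.1 * w p ∂(π i : Measure ((S (some i)).Path × (S none).Path)) := by
      intro F hF
      rw [hQ, lintegral_glue_some (E := fun j => (S j).Path) P κ hGm i hF,
        ← lintegral_indicator ((hGm none).prod (hGm (some i))), ← hswap i,
        lintegral_map (f := fun p => F p.1 * w p) ((hF.comp measurable_fst).mul hwm)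
          measurable_swap]
      refine lintegral_congr_ae ?_
      filter_upwards [hprod] with p hp
      simp only [w, Prod.fst_swap, Prod.snd_swap]
      by_cases h1 : p.1 ∈ G none
      · by_cases h2 : p.2 ∈ G (some i)
        · rw [indicator_of_mem (mk_mem_prod h1 h2), hp]
          simp [h1, h2]
        · rw [indicator_of_notMem fun h => h2 h.2]
          simp [h2]
      · rw [indicator_of_notMem fun h => h1 h.1]
        simp [h1]
    rw [hF _ (measurable_one.indicator hA), hF _ (ha.mono ((S (some i)).filt_le t) le_rfl), ← hag w hw,
      ← lintegral_indicator (measurable_fst hA)]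
    refine lintegral_congr fun p => ?_
    by_cases hpA : p.1 ∈ A <;> simp [hpA]

end

/-! ### Extended-real sums and expectations -/

section

open Set

theorem ereal_coe_sum {ι : Type*} (s : Finset ι) (f : ι → ℝ) :
    ((∑ i ∈ s, f i : ℝ) : EReal) = ∑ i ∈ s, (f i : EReal) := by
  classical
  induction s using Finset.induction_on with
  | empty => simp
  | insert i s hi ih => rw [Finset.sum_insert hi, Finset.sum_insert hi, EReal.coe_add, ih]

theorem ereal_coe_ennreal_sum {ι : Type*} (s : Finset ι) (f : ι → ENNReal) :
    ((∑ i ∈ s, f i : ENNReal) : EReal) = ∑ i ∈ s, (f i : EReal) := by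
  classical
  induction s using Finset.induction_on with
  | empty => simp
  | insert i s hi ih =>
    rw [Finset.sum_insert hi, Finset.sum_insert hi, EReal.coe_ennreal_add, ih]

theorem ereal_sum_ne_bot {ι : Type*} (s : Finset ι) (f : ι → EReal) (h : ∀ i, f i ≠ ⊥) :
    ∑ i ∈ s, f i ≠ ⊥ := by
  classical
  induction s using Finset.induction_on with
  | empty => simp
  | insert i s hi ih => rw [Finset.sum_insert hi]; simp [EReal.add_eq_bot_iff, h i, ih]

/-- A lower bound for all sums of values of families is a lower bound for the sum of the infima. -/
theorem le_sum_iInf {ι : Type*} [Fintype ι] {κ : ι → Type*} (S : ∀ i, Set (κ i))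
    (f : ∀ i, κ i → EReal) (hbot : ∀ i, ⨅ k ∈ S i, f i k ≠ ⊥) {v : EReal}
    (h : ∀ k : ∀ i, κ i, (∀ i, k i ∈ S i) → v ≤ ∑ i, f i (k i)) :
    v ≤ ∑ i, ⨅ k ∈ S i, f i k := by
  classical
  -- No summand is `⊥`, so a single infinite infimum makes the whole sum `⊤`.
  by_cases htop : ∃ i, ⨅ k ∈ S i, f i k = ⊤
  · obtain ⟨i, hi⟩ := htop
    rw [← Finset.add_sum_erase _ _ (Finset.mem_univ i), hi,
      EReal.top_add_of_ne_bot (ereal_sum_ne_bot _ _ hbot)]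
    exact le_top
  · push Not at htop
    let r : ι → ℝ := fun i => (⨅ k ∈ S i, f i k).toReal
    have hr : ∀ i, ⨅ k ∈ S i, f i k = (r i : EReal) := fun i =>
      (EReal.coe_toReal (htop i) (hbot i)).symm
    simp_rw [hr]
    rw [← ereal_coe_sum]
    refine EReal.le_of_forall_lt_iff_le.1 fun z hz => ?_
    have hz' : ∑ i, r i < z := EReal.coe_lt_coe_iff.1 hz
    -- The added 1 keeps the denominator positive when `ι` is empty.
    let ε : ℝ := (z - ∑ i, r i) / (Fintype.card ι + 1)
    have hε : 0 < ε := div_pos (sub_pos.2 hz') (by positivity)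
    have hex : ∀ i, ∃ k ∈ S i, f i k < ((r i + ε : ℝ) : EReal) := by
      intro i
      have hlt : ⨅ k ∈ S i, f i k < ((r i + ε : ℝ) : EReal) := by
        rw [hr i]
        exact EReal.coe_lt_coe_iff.2 (by linarith)
      simpa only [iInf_lt_iff, exists_prop] using hlt
    choose k hkS hk using hex
    calc v ≤ ∑ i, f i (k i) := h k hkS
      _ ≤ ∑ i, ((r i + ε : ℝ) : EReal) := Finset.sum_le_sum fun i _ => (hk i).le
      _ = ((∑ i, (r i + ε) : ℝ) : EReal) := (ereal_coe_sum _ _).symm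
      _ ≤ z := by
        refine EReal.coe_le_coe_iff.2 ?_
        rw [Finset.sum_add_distrib, Finset.sum_const, Finset.card_univ, nsmul_eq_mul]
        have : (Fintype.card ι + 1) * ε = z - ∑ i, r i := by
          simp only [ε]; field_simp
        linarith

section Expect

variable {α : Type*} [MeasurableSpace α] {μ : Measure α}

theorem expect_mono_ae {f g : α → ℝ} (h : f ≤ᵐ[μ] g) : expect μ f ≤ expect μ g := by
  refine EReal.sub_le_sub ?_ ?_
  · refine EReal.coe_ennreal_le_coe_ennreal_iff.2 (lintegral_mono_ae ?_)
    filter_upwards [h] with a ha using ENNReal.ofReal_le_ofReal ha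
  · refine EReal.coe_ennreal_le_coe_ennreal_iff.2 (lintegral_mono_ae ?_)
    filter_upwards [h] with a ha using ENNReal.ofReal_le_ofReal (neg_le_neg ha)

theorem expect_map {β : Type*} [MeasurableSpace β] {φ : α → β} (hφ : Measurable φ) {f : β → ℝ}
    (hf : Measurable f) : expect (μ.map φ) f = expect μ fun a => f (φ a) := by
  simp only [expect]
  rw [lintegral_map hf.ennreal_ofReal hφ,
    lintegral_map (f := fun b => ENNReal.ofReal (-f b)) hf.neg.ennreal_ofReal hφ]

variable [IsProbabilityMeasure μ]

/-- Shifting by the lower bound replaces a difference of two integrals by one nonnegative integral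
and a constant, so additivity reduces to that of `lintegral`. -/
theorem expect_eq_lintegral_add {f : α → ℝ} (hf : Measurable f) {b : ℝ} (hb : ∀ a, b ≤ f a) :
    expect μ f = ((∫⁻ a, ENNReal.ofReal (f a - b) ∂μ : ENNReal) : EReal) + b := by
  have hkey : ∫⁻ a, ENNReal.ofReal (f a) ∂μ + ENNReal.ofReal (-b) =
      ∫⁻ a, ENNReal.ofReal (f a - b) ∂μ + ∫⁻ a, ENNReal.ofReal (-f a) ∂μ + ENNReal.ofReal b := by
    -- The subtraction-free form f⁺ + b⁻ = (f - b) + f⁻ + b⁺ can be integrated in `ENNReal`.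
    have hpt : ∀ a, ENNReal.ofReal (f a) + ENNReal.ofReal (-b) =
        ENNReal.ofReal (f a - b) + ENNReal.ofReal (-f a) + ENNReal.ofReal b := by
      intro a
      have h := hb a
      rcases le_total 0 (f a) with h1 | h1 <;> rcases le_total 0 b with h2 | h2
      · rw [ENNReal.ofReal_of_nonpos (neg_nonpos.2 h2), ENNReal.ofReal_of_nonpos (neg_nonpos.2 h1),
          add_zero, add_zero, ← ENNReal.ofReal_add (by linarith) h2, sub_add_cancel]
      · rw [ENNReal.ofReal_of_nonpos (neg_nonpos.2 h1), ENNReal.ofReal_of_nonpos h2, add_zero,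
          add_zero, ← ENNReal.ofReal_add h1 (by linarith), sub_eq_add_neg]
      · rw [le_antisymm (h.trans h1) h2, le_antisymm h1 (h2.trans h)]
        simp
      · rw [ENNReal.ofReal_of_nonpos h1, ENNReal.ofReal_of_nonpos h2, add_zero, zero_add,
          ← ENNReal.ofReal_add (by linarith) (by linarith)]
        congr 1
        ring
    have h1 : ∫⁻ a, (ENNReal.ofReal (f a) + ENNReal.ofReal (-b)) ∂μ =
        ∫⁻ a, ENNReal.ofReal (f a) ∂μ + ENNReal.ofReal (-b) := by
      rw [lintegral_add_right _ measurable_const]; simp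
    have h2 : ∫⁻ a, (ENNReal.ofReal (f a - b) + ENNReal.ofReal (-f a) + ENNReal.ofReal b) ∂μ =
        ∫⁻ a, ENNReal.ofReal (f a - b) ∂μ + ∫⁻ a, ENNReal.ofReal (-f a) ∂μ +
          ENNReal.ofReal b := by
      rw [lintegral_add_right _ measurable_const,
        lintegral_add_left (hf.sub_const b).ennreal_ofReal]
      simp
    rw [← h1, ← h2]
    exact lintegral_congr hpt
  have hn : ∫⁻ a, ENNReal.ofReal (-f a) ∂μ ≠ ⊤ := by
    refine ne_top_of_le_ne_top (b := ENNReal.ofReal (-b)) ENNReal.ofReal_ne_top ?_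
    calc ∫⁻ a, ENNReal.ofReal (-f a) ∂μ ≤ ∫⁻ _, ENNReal.ofReal (-b) ∂μ :=
          lintegral_mono fun a => ENNReal.ofReal_le_ofReal (neg_le_neg (hb a))
      _ = _ := by simp
  unfold expect
  generalize ∫⁻ a, ENNReal.ofReal (-f a) ∂μ = n at *
  generalize ∫⁻ a, ENNReal.ofReal (f a) ∂μ = p at *
  generalize ∫⁻ a, ENNReal.ofReal (f a - b) ∂μ = q at *
  lift n to NNReal using hn
  by_cases hq : q = ⊤
  · subst hq
    have hp : p = ⊤ := by
      rcases ENNReal.add_eq_top.1 (hkey.trans (by simp)) with h | h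
      · exact h
      · exact absurd h ENNReal.ofReal_ne_top
    subst hp
    rfl
  · lift q to NNReal using hq
    have hp : p ≠ ⊤ := by
      intro hp
      rw [hp, top_add] at hkey
      exact (ENNReal.add_ne_top.2 ⟨ENNReal.add_ne_top.2 ⟨by simp, by simp⟩, by simp⟩) hkey.symm
    lift p to NNReal using hp
    have hreal := congrArg ENNReal.toReal hkey
    rw [ENNReal.toReal_add (by simp) (by simp),
      ENNReal.toReal_add (ENNReal.add_ne_top.2 ⟨by simp, by simp⟩) (by simp),
      ENNReal.toReal_add (by simp) (by simp), ENNReal.toReal_ofReal', ENNReal.toReal_ofReal'] at hreal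
    have hb' : max b 0 - max (-b) 0 = b := max_zero_sub_max_neg_zero_eq_self b
    change (((p : ℝ) : EReal) - ((n : ℝ) : EReal)) = ((q : ℝ) : EReal) + (b : EReal)
    rw [← EReal.coe_sub, ← EReal.coe_add, EReal.coe_eq_coe_iff]
    simp only [ENNReal.coe_toReal] at hreal
    linarith

theorem coe_le_expect {f : α → ℝ} (hf : Measurable f) {b : ℝ} (hb : ∀ a, b ≤ f a) :
    (b : EReal) ≤ expect μ f := by
  rw [expect_eq_lintegral_add hf hb]
  exact le_add_of_nonneg_left (EReal.coe_ennreal_nonneg _)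

theorem expect_add_const {f : α → ℝ} (hf : Measurable f) {b : ℝ} (hb : ∀ a, b ≤ f a) (r : ℝ) :
    expect μ (fun a => f a + r) = expect μ f + r := by
  rw [expect_eq_lintegral_add hf hb, expect_eq_lintegral_add (hf.add_const r) (b := b + r)
    fun a => by linarith [hb a]]
  simp only [add_sub_add_right_eq_sub, EReal.coe_add, add_assoc]

theorem expect_sum {ι : Type*} [Fintype ι] {f : ι → α → ℝ} (hf : ∀ i, Measurable (f i))
    {b : ι → ℝ} (hb : ∀ i a, b i ≤ f i a) :
    expect μ (fun a => ∑ i, f i a) = ∑ i, expect μ (f i) := by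
  rw [expect_eq_lintegral_add (Finset.measurable_sum _ fun i _ => hf i) (b := ∑ i, b i)
    fun a => Finset.sum_le_sum fun i _ => hb i a]
  simp_rw [fun i => expect_eq_lintegral_add (μ := μ) (hf i) (hb i)]
  rw [Finset.sum_add_distrib, ← ereal_coe_sum, ← ereal_coe_ennreal_sum,
    ← lintegral_finsetSum _ fun i _ => ((hf i).sub_const (b i)).ennreal_ofReal]
  congr 3
  funext a
  rw [← ENNReal.ofReal_sum_of_nonneg fun i _ => sub_nonneg.2 (hb i a), Finset.sum_sub_distrib]

end Expect

end

/-! ### Multicausal couplings: marginals and the induced filtered space -/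

section

open Set

variable {T N : ℕ}

theorem condIndep_of_eq {Ω : Type*} {m' m₁ m₂ n' n₁ n₂ mΩ : MeasurableSpace Ω}
    [StandardBorelSpace Ω] {μ : Measure Ω} [IsFiniteMeasure μ] {hm' : m' ≤ mΩ}
    (h : CondIndep m' m₁ m₂ hm' μ) (h' : n' = m') (h₁ : n₁ = m₁) (h₂ : n₂ = m₂) :
    CondIndep n' n₁ n₂ (h'.le.trans hm') μ := by
  subst h' h₁ h₂
  exact h

section Couplings

variable {ι : Type}

theorem marginalFst_mem_cplMc [Fintype ι] {S : ι → FilteredSpace.{u} T} {S' : FilteredSpace.{u} T}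
    {Q : ProbabilityMeasure (∀ j, (adjoin S S' j).Path)} (hQ : Q ∈ cplMc (adjoin S S')) :
    marginalFst S S' Q ∈ cplMc S := by
  have hf : Measurable fun (ω : ∀ j, (adjoin S S' j).Path) (i : ι) => ω (some i) :=
    measurable_pi_lambda _ fun i => measurable_pi_apply (some i)
  refine ⟨fun i => ?_, fun t ht i => ?_⟩
  · rw [← hQ.1 (some i)]
    exact Measure.map_map (measurable_pi_apply i) hf
  · have hcoord : ∀ i t, (coordFilt S i t).comap
        (fun (ω : ∀ j, (adjoin S S' j).Path) (i : ι) => ω (some i)) =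
          coordFilt (adjoin S S') (some i) t := fun i t => MeasurableSpace.comap_comp
    have hprod : (prodFilt S t).comap
        (fun (ω : ∀ j, (adjoin S S' j).Path) (i : ι) => ω (some i)) ≤
          prodFilt (adjoin S S') t := by
      rw [prodFilt, MeasurableSpace.comap_iSup]
      refine iSup_le fun i => ?_
      rw [hcoord]
      exact le_iSup (fun j => coordFilt (adjoin S S') j t) (some i)
    refine condIndep_map hf (coordFilt_le S i t) (coordFilt_le S i T) (prodFilt_le S t) ?_
    refine condIndep_of_condIndep_of_le_right ?_ hprod
    simp only [hcoord]
    exact hQ.2 t ht (some i)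

/-- Exchanging the order of the process index and the time index. -/
def transpose [Fintype ι] (S : ι → FilteredSpace.{u} T) (π : ProbabilityMeasure (∀ i, (S i).Path))
    (ω : ∀ i, (S i).Path) : (prodSpace S π).Path :=
  fun t i => ω i t

theorem measurable_transpose [Fintype ι] (S : ι → FilteredSpace.{u} T)
    (π : ProbabilityMeasure (∀ i, (S i).Path)) : Measurable (transpose S π) :=
  measurable_pi_lambda _ fun t => measurable_pi_lambda _ fun i =>
    (measurable_pi_apply t).comp (measurable_pi_apply i)

/-- Both sides are generated by the coordinates `ω i s` with `s < t`; only the order of the two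
suprema differs. -/
theorem comap_transpose_filt [Fintype ι] (S : ι → FilteredSpace.{u} T)
    (π : ProbabilityMeasure (∀ i, (S i).Path)) (t : ℕ) :
    ((prodSpace S π).filt t).comap (transpose S π) = prodFilt S t := by
  unfold prodFilt coordFilt FilteredSpace.filt
  simp only [MeasurableSpace.comap_iSup, MeasurableSpace.comap_comp]
  rw [iSup_comm]
  refine iSup_congr fun s => ?_
  change MeasurableSpace.comap (fun (ω : ∀ i, (S i).Path) (i : ι) => ω i s.1) MeasurableSpace.pi = _
  simp only [MeasurableSpace.pi, MeasurableSpace.comap_iSup, MeasurableSpace.comap_comp]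
  rfl

/-- A multicausal coupling induces a bicausal coupling of each of its marginals with the
product space. -/
theorem map_transpose_mem_cplBc [Fintype ι] {S : ι → FilteredSpace.{u} T}
    {π : ProbabilityMeasure (∀ i, (S i).Path)} (hπ : π ∈ cplMc S) (i : ι) :
    π.map (f := fun ω => (ω i, transpose S π ω))
      ((measurable_pi_apply i).prodMk (measurable_transpose S π)).aemeasurable ∈
      cplBc (S i) (prodSpace S π) := by
  have hf : Measurable fun ω : ∀ i, (S i).Path => (ω i, transpose S π ω) :=
    (measurable_pi_apply i).prodMk (measurable_transpose S π)
  refine ⟨?_, ?_, fun t ht => ?_, fun t _ => ?_⟩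
  · rw [← hπ.1 i]
    exact Measure.map_map measurable_fst hf
  · exact Measure.map_map measurable_snd hf
  · refine condIndep_map hf
      ((MeasurableSpace.comap_mono ((S i).filt_le t)).trans measurable_fst.comap_le)
      ((MeasurableSpace.comap_mono ((S i).filt_le T)).trans measurable_fst.comap_le)
      ((MeasurableSpace.comap_mono ((prodSpace S π).filt_le t)).trans measurable_snd.comap_le) ?_
    refine condIndep_of_eq (hπ.2 t ht i) MeasurableSpace.comap_comp MeasurableSpace.comap_comp ?_
    exact MeasurableSpace.comap_comp.trans (comap_transpose_filt S π t)
  -- The reverse causality is trivial: the past of `S i` is part of the past of the product space.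
  · have h₁ : ∀ r, MeasurableSpace.comap (Prod.fst (β := (S i).Path)) ((prodSpace S π).filt r) ≤
        Prod.instMeasurableSpace := fun r =>
      (MeasurableSpace.comap_mono ((prodSpace S π).filt_le r)).trans measurable_fst.comap_le
    have h₂ : MeasurableSpace.comap (Prod.snd (α := (prodSpace S π).Path)) ((S i).filt t) ≤
        Prod.instMeasurableSpace :=
      (MeasurableSpace.comap_mono ((S i).filt_le t)).trans measurable_snd.comap_le
    have hs := fun m (hm : m ≤ Prod.instMeasurableSpace) =>
      (MeasurableSpace.comap_mono hm).trans
        (measurable_swap (α := (S i).Path) (β := (prodSpace S π).Path)).comap_le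
    refine condIndep_map measurable_swap (h₁ t) (h₁ T) h₂ ?_
    refine condIndep_map hf (hs _ (h₁ t)) (hs _ (h₁ T)) (hs _ h₂) ?_
    refine condIndep_of_le _ ((MeasurableSpace.comap_mono (hs _ (h₁ T))).trans hf.comap_le) ?_
    simp only [MeasurableSpace.comap_comp]
    refine le_trans ?_ (comap_transpose_filt S π t).ge
    exact le_iSup (fun i => coordFilt S i t) i

end Couplings

end

/-! ### Separable costs and comparison of the two values -/

section Problems

variable {T N : ℕ} {𝒳 : Fin T → Type v} {𝒴 : Fin T → Type w}

section Costs

variable {c : Fin N → ∀ t, 𝒳 t → 𝒴 t → ℝ} {b : Fin N → Fin T → ℝ}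

/-- The multimarginal cost at time `t`. -/
def stepCost (c : Fin N → ∀ t, 𝒳 t → 𝒴 t → ℝ) (t : Fin T) (x : Fin N → 𝒳 t) : ℝ :=
  ⨅ y, ∑ i, c i t (x i) y

theorem stepCost_le (hb : ∀ i t x y, b i t ≤ c i t x y) (t : Fin T) (x : Fin N → 𝒳 t) (y : 𝒴 t) :
    stepCost c t x ≤ ∑ i, c i t (x i) y :=
  ciInf_le ⟨∑ i, b i t, by rintro _ ⟨y, rfl⟩; exact Finset.sum_le_sum fun i _ => hb i t _ _⟩ y

theorem le_sepCost (hb : ∀ i t x y, b i t ≤ c i t x y) (i : Fin N) (x : ∀ t, 𝒳 t) (y : ∀ t, 𝒴 t) :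
    ∑ t, b i t ≤ sepCost (c i) x y :=
  Finset.sum_le_sum fun t _ => hb i t _ _

theorem exists_sum_le_stepCost_add [∀ t, Nonempty (𝒴 t)] (t : Fin T) (x : Fin N → 𝒳 t) {ε : ℝ}
    (hε : 0 < ε) : ∃ y, ∑ i, c i t (x i) y ≤ stepCost c t x + ε := by
  obtain ⟨y, hy⟩ := exists_lt_of_ciInf_lt (lt_add_of_pos_right (stepCost c t x) hε)
  exact ⟨y, hy.le⟩

theorem infCost_le (hb : ∀ i t x y, b i t ≤ c i t x y) (x : Fin N → ∀ t, 𝒳 t) (y : ∀ t, 𝒴 t) :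
    infCost (fun i => sepCost (c i)) x ≤ ∑ i, sepCost (c i) (x i) y :=
  ciInf_le ⟨∑ i, ∑ t, b i t, by
    rintro _ ⟨y, rfl⟩; exact Finset.sum_le_sum fun i _ => le_sepCost hb i _ _⟩ y

/-- The multimarginal cost of a separable cost is separable. -/
theorem infCost_sepCost [∀ t, Nonempty (𝒴 t)] (hb : ∀ i t x y, b i t ≤ c i t x y)
    (x : Fin N → ∀ t, 𝒳 t) :
    infCost (fun i => sepCost (c i)) x = ∑ t, stepCost c t fun i => x i t := by
  refine le_antisymm (le_of_forall_pos_le_add fun ε hε => ?_) (le_ciInf fun y => ?_)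
  · have hε' : 0 < ε / (T + 1) := by positivity
    choose y hy using fun t => exists_sum_le_stepCost_add (c := c) t (fun i => x i t) hε'
    calc infCost (fun i => sepCost (c i)) x ≤ ∑ i, sepCost (c i) (x i) y := infCost_le hb x y
      _ = ∑ t, ∑ i, c i t (x i t) (y t) := Finset.sum_comm
      _ ≤ ∑ t, (stepCost c t (fun i => x i t) + ε / (T + 1)) := Finset.sum_le_sum fun t _ => hy t
      _ = ∑ t, stepCost c t (fun i => x i t) + T * (ε / (T + 1)) := by
          simp [Finset.sum_add_distrib]
      _ ≤ ∑ t, stepCost c t (fun i => x i t) + ε := by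
          have : T * (ε / (T + 1)) + ε / (T + 1) = ε := by field_simp
          linarith
  · calc ∑ t, stepCost c t (fun i => x i t) ≤ ∑ t, ∑ i, c i t (x i t) (y t) :=
          Finset.sum_le_sum fun t _ => stepCost_le hb t _ _
      _ = ∑ i, sepCost (c i) (x i) y := Finset.sum_comm

theorem le_infCost [∀ t, Nonempty (𝒴 t)] (hb : ∀ i t x y, b i t ≤ c i t x y)
    (x : Fin N → ∀ t, 𝒳 t) : ∑ i, ∑ t, b i t ≤ infCost (fun i => sepCost (c i)) x :=
  le_ciInf fun _ => Finset.sum_le_sum fun i _ => le_sepCost hb i _ _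

variable [∀ t, MeasurableSpace (𝒳 t)]

/-- With all other times frozen at arbitrary points, `infCost` is `stepCost c t` plus a constant. -/
theorem measurable_stepCost [∀ t, Nonempty (𝒳 t)] [∀ t, Nonempty (𝒴 t)]
    (hb : ∀ i t x y, b i t ≤ c i t x y) (h : Measurable (infCost fun i => sepCost (c i)))
    (t : Fin T) : Measurable (stepCost c t) := by
  classical
  let z : ∀ s, Fin N → 𝒳 s := fun s _ => Classical.arbitrary _
  have hup : Measurable fun (x : Fin N → 𝒳 t) (i : Fin N) (s : Fin T) =>
      Function.update z t x s i := by
    refine measurable_pi_lambda _ fun i => measurable_pi_lambda _ fun s => ?_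
    rcases eq_or_ne s t with rfl | hs
    · simpa using measurable_pi_apply i
    · simp only [Function.update_of_ne hs]
      exact measurable_const
  have heq : stepCost c t = fun x => infCost (fun i => sepCost (c i))
      (fun i s => Function.update z t x s i) - ∑ s ∈ Finset.univ.erase t, stepCost c s (z s) := by
    funext x
    have hne : ∀ s ∈ Finset.univ.erase t,
        (stepCost c s fun i => Function.update z t x s i) = stepCost c s (z s) := fun s hs =>
      congrArg (stepCost c s) (Function.update_of_ne (Finset.ne_of_mem_erase hs) x z)
    rw [infCost_sepCost hb, ← Finset.add_sum_erase _ _ (Finset.mem_univ t),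
      Finset.sum_congr rfl hne, Function.update_self]
    exact (add_sub_cancel_right _ _).symm
  rw [heq]
  exact (h.comp hup).sub_const _

variable [∀ t, MeasurableSpace (𝒴 t)]

theorem measurable_sepCost (hc : ∀ i t, Measurable (Function.uncurry (c i t))) (i : Fin N) :
    Measurable fun p : (∀ t, 𝒳 t) × (∀ t, 𝒴 t) => sepCost (c i) p.1 p.2 :=
  Finset.measurable_sum _ fun t _ => (hc i t).comp
    (((measurable_pi_apply t).comp measurable_fst).prodMk
      ((measurable_pi_apply t).comp measurable_snd))

end Costs

variable [∀ t, MeasurableSpace (𝒳 t)] [∀ t, MeasurableSpace (𝒴 t)]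

theorem FilteredProcess.measurable_X (X : FilteredProcess.{u} T 𝒳) (t : Fin T) :
    Measurable (X.X t) :=
  (X.adapted t).mono (X.filt_le _) le_rfl

theorem FilteredProcess.measurable_path (X : FilteredProcess.{u} T 𝒳) : Measurable X.path :=
  measurable_pi_lambda _ X.measurable_X

variable {c : Fin N → ∀ t, 𝒳 t → 𝒴 t → ℝ} {b : Fin N → Fin T → ℝ}
  {X : Fin N → FilteredProcess.{u} T 𝒳}

theorem measurable_bcCost_integrand (hc : ∀ i t, Measurable (Function.uncurry (c i t)))
    (Y : FilteredProcess.{u} T 𝒴) (i : Fin N) :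
    Measurable fun ω : (X i).Path × Y.Path => sepCost (c i) ((X i).path ω.1) (Y.path ω.2) :=
  (measurable_sepCost hc i).comp (((X i).measurable_path.comp measurable_fst).prodMk
    (Y.measurable_path.comp measurable_snd))

theorem measurable_paths : Measurable fun (ω : ∀ i, (X i).Path) i => (X i).path (ω i) :=
  measurable_pi_lambda _ fun i => (X i).measurable_path.comp (measurable_pi_apply i)

theorem bcValue_ne_bot (hc : ∀ i t, Measurable (Function.uncurry (c i t)))
    (hb : ∀ i t x y, b i t ≤ c i t x y) (Y : FilteredProcess.{u} T 𝒴) (i : Fin N) :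
    bcValue (sepCost (c i)) (X i) Y ≠ ⊥ := by
  refine ne_bot_of_le_ne_bot (EReal.coe_ne_bot (∑ t, b i t)) (le_iInf₂ fun π _ => ?_)
  exact coe_le_expect (measurable_bcCost_integrand hc Y i) fun _ => le_sepCost hb i _ _

/-- The multicausal cost of a gluing is at most the sum of the bicausal costs. -/
theorem mcCost_marginalFst_le (hc : ∀ i t, Measurable (Function.uncurry (c i t)))
    (hb : ∀ i t x y, b i t ≤ c i t x y) (hinf : Measurable (infCost fun i => sepCost (c i)))
    {Y : FilteredProcess.{u} T 𝒴} {π : ∀ i, ProbabilityMeasure ((X i).Path × Y.Path)}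
    {Q : ProbabilityMeasure
      (∀ j, (adjoin (fun i => (X i).toFilteredSpace) Y.toFilteredSpace j).Path)}
    (hQ : IsGluing (fun i => (X i).toFilteredSpace) Y.toFilteredSpace π Q) :
    mcCost (infCost fun i => sepCost (c i)) X
        (marginalFst (fun i => (X i).toFilteredSpace) Y.toFilteredSpace Q) ≤
      ∑ i, bcCost (sepCost (c i)) (X i) Y (π i) := by
  have hpair : ∀ i, Measurable fun ω : ∀ j, (adjoin (fun i => (X i).toFilteredSpace)
      Y.toFilteredSpace j).Path => ((ω (some i), ω none) : (X i).Path × Y.Path) := fun i =>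
    (measurable_pi_apply (some i)).prodMk (measurable_pi_apply none)
  have hmarg : Measurable fun (ω : ∀ j, (adjoin (fun i => (X i).toFilteredSpace)
      Y.toFilteredSpace j).Path) (i : Fin N) => (ω (some i) : (X i).Path) :=
    measurable_pi_lambda _ fun i => measurable_pi_apply (some i)
  have hsum : ∀ i, bcCost (sepCost (c i)) (X i) Y (π i) = expect
      (Q : Measure (∀ j, (adjoin (fun i => (X i).toFilteredSpace) Y.toFilteredSpace j).Path))
      fun ω => sepCost (c i) ((X i).path (ω (some i))) (Y.path (ω none)) := by
    intro i
    rw [bcCost, ← hQ.2 i, expect_map (hpair i) (measurable_bcCost_integrand hc Y i)]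
  simp_rw [hsum]
  refine LE.le.trans_eq ?_ (expect_sum
    (fun i => (measurable_bcCost_integrand hc Y i).comp (hpair i))
    (b := fun i => ∑ t, b i t) fun i _ => le_sepCost hb i _ _)
  refine (expect_map hmarg (hinf.comp measurable_paths)).trans_le ?_
  exact expect_mono_ae (ae_of_all _ fun ω => infCost_le hb _ _)

/-- Any family of bicausal plans with the same second process can be glued, so the plans may be
optimized separately for each `i`. -/
theorem mcValue_le_baryFunctional (hc : ∀ i t, Measurable (Function.uncurry (c i t)))
    (hb : ∀ i t x y, b i t ≤ c i t x y) (hinf : Measurable (infCost fun i => sepCost (c i)))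
    (Y : FilteredProcess.{u} T 𝒴) :
    mcValue (infCost fun i => sepCost (c i)) X ≤ baryFunctional (fun i => sepCost (c i)) X Y := by
  refine le_sum_iInf _ _ (bcValue_ne_bot hc hb Y) fun π hπ => ?_
  obtain ⟨Q, hQ⟩ := exists_mem_cplMc_map_eq
    (adjoin (fun i => (X i).toFilteredSpace) Y.toFilteredSpace) π hπ
  exact (iInf₂_le _ (marginalFst_mem_cplMc hQ.1)).trans (mcCost_marginalFst_le hc hb hinf hQ)

/-- The barycenter functional at an induced process is at most the cost of the multicausal
coupling that induces it. -/
theorem baryFunctional_inducedProcess_le (hc : ∀ i t, Measurable (Function.uncurry (c i t)))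
    (hb : ∀ i t x y, b i t ≤ c i t x y) {π : ProbabilityMeasure (∀ i, (X i).Path)}
    (hπ : π ∈ cplMc fun i => (X i).toFilteredSpace) {ψ : ∀ t, (Fin N → 𝒳 t) → 𝒴 t}
    (hψ : ∀ t, Measurable (ψ t)) :
    baryFunctional (fun i => sepCost (c i)) X (inducedProcess X π ψ hψ) ≤
      expect (π : Measure (∀ i, (X i).Path)) fun ω =>
        ∑ t, ∑ i, c i t ((X i).X t (ω i)) (ψ t fun i => (X i).X t (ω i)) := by
  let S : Fin N → FilteredSpace.{u} T := fun i => (X i).toFilteredSpace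
  let Y := inducedProcess X π ψ hψ
  have hf : ∀ i, Measurable fun ω : ∀ i, (X i).Path => (ω i, transpose S π ω) := fun i =>
    (measurable_pi_apply i).prodMk (measurable_transpose S π)
  have hcost : ∀ i, bcCost (sepCost (c i)) (X i) Y (π.map (hf i).aemeasurable) =
      expect (π : Measure (∀ i, (X i).Path)) fun ω =>
        sepCost (c i) ((X i).path (ω i)) (Y.path (transpose S π ω)) := fun i =>
    expect_map (hf i) (measurable_bcCost_integrand hc Y i)
  calc baryFunctional (fun i => sepCost (c i)) X Y
      ≤ ∑ i, bcCost (sepCost (c i)) (X i) Y (π.map (hf i).aemeasurable) :=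
        Finset.sum_le_sum fun i _ => iInf₂_le _ (map_transpose_mem_cplBc hπ i)
    _ = expect (π : Measure (∀ i, (X i).Path)) fun ω =>
          ∑ i, sepCost (c i) ((X i).path (ω i)) (Y.path (transpose S π ω)) := by
        simp_rw [hcost]
        exact (expect_sum (fun i => (measurable_bcCost_integrand hc Y i).comp (hf i))
          (b := fun i => ∑ t, b i t) fun i _ => le_sepCost hb i _ _).symm
    _ = _ := by
        congr 1
        funext ω
        exact Finset.sum_comm

theorem baryValue_le_mcValue [∀ t, StandardBorelSpace (𝒳 t)] [∀ t, StandardBorelSpace (𝒴 t)]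
    [∀ t, Nonempty (𝒴 t)] (hN : 1 ≤ N) (hc : ∀ i t, Measurable (Function.uncurry (c i t)))
    (hb : ∀ i t x y, b i t ≤ c i t x y) (hinf : Measurable (infCost fun i => sepCost (c i))) :
    baryValue (fun i => sepCost (c i)) X ≤ mcValue (infCost fun i => sepCost (c i)) X := by
  refine le_iInf₂ fun π hπ => ?_
  -- A probability space is nonempty, so the first process takes some value; this is where `1 ≤ N`
  -- enters.
  have hXne : ∀ t, Nonempty (𝒳 t) := fun t =>
    (nonempty_of_isProbabilityMeasure (X ⟨0, hN⟩).P).map ((X ⟨0, hN⟩).X t)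
  have hint : Measurable fun ω : ∀ i, (X i).Path =>
      infCost (fun i => sepCost (c i)) fun i => (X i).path (ω i) := hinf.comp measurable_paths
  have hε : ∀ ε : ℝ, 0 < ε → baryValue (fun i => sepCost (c i)) X ≤
      mcCost (infCost fun i => sepCost (c i)) X π + (T * ε : ℝ) := by
    intro ε hε
    have hXt : ∀ t, Measurable fun (ω : ∀ i, (X i).Path) i => (X i).X t (ω i) := fun t =>
      measurable_pi_lambda _ fun i => ((X i).measurable_X t).comp (measurable_pi_apply i)
    -- A Borel ε-minimizer at time `t`, valid almost everywhere for the law of the values at time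
    -- `t`; the errors add up to `T * ε`.
    have hsel : ∀ t, ∃ ψ : (Fin N → 𝒳 t) → 𝒴 t, Measurable ψ ∧
        ∀ᵐ x ∂(π : Measure (∀ i, (X i).Path)).map fun ω i => (X i).X t (ω i),
          ∑ i, c i t (x i) (ψ x) ≤ stepCost c t x + ε := by
      intro t
      refine exists_measurable_ae_mem _
        (D := {p : (Fin N → 𝒳 t) × 𝒴 t | ∑ i, c i t (p.1 i) p.2 ≤ stepCost c t p.1 + ε}) ?_
        fun x => exists_sum_le_stepCost_add t x hε
      have hci : ∀ i, Measurable fun p : (Fin N → 𝒳 t) × 𝒴 t => c i t (p.1 i) p.2 := fun i =>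
        (hc i t).comp (f := fun p : (Fin N → 𝒳 t) × 𝒴 t => (p.1 i, p.2))
          (((measurable_pi_apply i).comp measurable_fst).prodMk measurable_snd)
      exact measurableSet_le (Finset.measurable_sum _ fun i _ => hci i)
        (((measurable_stepCost hb hinf t).comp measurable_fst).add_const ε)
    choose ψ hψ hψle using hsel
    refine (iInf_le _ (inducedProcess X π ψ hψ)).trans
      ((baryFunctional_inducedProcess_le hc hb hπ hψ).trans ?_)
    rw [mcCost, ← expect_add_const hint fun ω => le_infCost hb _]
    refine expect_mono_ae ?_
    filter_upwards [ae_all_iff.2 fun t => ae_of_ae_map (hXt t).aemeasurable (hψle t)] with ω hω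
    rw [infCost_sepCost hb]
    calc _ ≤ ∑ t, (stepCost c t (fun i => (X i).X t (ω i)) + ε) :=
          Finset.sum_le_sum fun t _ => hω t
      _ = _ := by simp [Finset.sum_add_distrib, FilteredProcess.path]
  have hbot : mcCost (infCost fun i => sepCost (c i)) X π ≠ ⊥ :=
    ne_bot_of_le_ne_bot (EReal.coe_ne_bot _) (coe_le_expect hint fun ω => le_infCost hb _)
  -- Testing against reals `z` above the cost also settles infinite cost, for which there is no such
  -- `z`.
  refine EReal.le_of_forall_lt_iff_le.1 fun z hz => ?_
  obtain ⟨r, hr⟩ : ∃ r : ℝ, mcCost (infCost fun i => sepCost (c i)) X π = r :=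
    ⟨_, (EReal.coe_toReal hz.ne_top hbot).symm⟩
  rw [hr] at hε hz
  have hz' : r < z := EReal.coe_lt_coe_iff.1 hz
  refine (hε ((z - r) / (T + 1)) (div_pos (sub_pos.2 hz') (by positivity))).trans ?_
  rw [← EReal.coe_add]
  refine EReal.coe_le_coe_iff.2 ?_
  have h1 : T * ((z - r) / (T + 1)) + (z - r) / (T + 1) = z - r := by field_simp
  have h2 : 0 < (z - r) / (T + 1 : ℝ) := div_pos (sub_pos.2 hz') (by positivity)
  linarith

theorem exists_isBorelVersion [∀ t, StandardBorelSpace (𝒴 t)] (π : ProbabilityMeasure (∀ i, (X i).Path))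
    {φ : ∀ t, (Fin N → 𝒳 t) → 𝒴 t} (hφ : ∀ t, UniversallyMeasurable (φ t)) :
    ∃ ψ, IsBorelVersion X π φ ψ := by
  have hXt : ∀ t, Measurable fun (ω : ∀ i, (X i).Path) i => (X i).X t (ω i) := fun t =>
    measurable_pi_lambda _ fun i => ((X i).measurable_X t).comp (measurable_pi_apply i)
  -- Universal measurability is applied to the law of (X¹_t, …, Xᴺ_t) under `π`.
  have hae : ∀ t, AEMeasurable (φ t)
      ((π : Measure (∀ i, (X i).Path)).map fun ω i => (X i).X t (ω i)) := fun t =>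
    (hφ t _ (Measure.isProbabilityMeasure_map (hXt t).aemeasurable)).aemeasurable
  refine ⟨fun t => (hae t).mk (φ t), fun t => ⟨(hae t).measurable_mk, ?_⟩⟩
  filter_upwards [ae_of_ae_map (hXt t).aemeasurable (hae t).ae_eq_mk] with ω hω using hω.symm

end Problems

end MulticausalOT

end

/-! ### Equality of the values and transfer of optimizers -/

theorem mainTheorem1 {T N : ℕ} (hT : 1 ≤ T) (hN : 1 ≤ N)
    (𝒳 : Fin T → Type v) [∀ t, MeasurableSpace (𝒳 t)] [∀ t, StandardBorelSpace (𝒳 t)]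
    (𝒴 : Fin T → Type w) [∀ t, MeasurableSpace (𝒴 t)] [∀ t, StandardBorelSpace (𝒴 t)]
    [∀ t, Nonempty (𝒴 t)]
    (X : Fin N → FilteredProcess.{u} T 𝒳)
    (c : Fin N → ∀ t, 𝒳 t → 𝒴 t → ℝ)
    (hc_meas : ∀ i t, Measurable (Function.uncurry (c i t)))
    (hc_bdd : ∀ i t, ∃ b : ℝ, ∀ x y, b ≤ c i t x y)
    (hc_inf : Measurable (infCost fun i => sepCost (c i))) :
    -- the two values agree
    baryValue (fun i => sepCost (c i)) X = mcValue (infCost fun i => sepCost (c i)) X ∧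
    -- gluing optimal bicausal plans to a barycenter gives a multicausal optimizer
    (∀ Ybar : FilteredProcess.{u} T 𝒴,
      baryFunctional (fun i => sepCost (c i)) X Ybar = baryValue (fun i => sepCost (c i)) X →
      ∀ π : ∀ i, ProbabilityMeasure ((X i).Path × Ybar.Path),
        (∀ i, π i ∈ cplBc (X i).toFilteredSpace Ybar.toFilteredSpace ∧
          bcCost (sepCost (c i)) (X i) Ybar (π i) = bcValue (sepCost (c i)) (X i) Ybar) →
        (∃ Q, IsGluing (fun i => (X i).toFilteredSpace) Ybar.toFilteredSpace π Q) ∧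
        ∀ Q, IsGluing (fun i => (X i).toFilteredSpace) Ybar.toFilteredSpace π Q →
          marginalFst (fun i => (X i).toFilteredSpace) Ybar.toFilteredSpace Q ∈
            cplMc (fun i => (X i).toFilteredSpace) ∧
          mcCost (infCost fun i => sepCost (c i)) X
              (marginalFst (fun i => (X i).toFilteredSpace) Ybar.toFilteredSpace Q) =
            mcValue (infCost fun i => sepCost (c i)) X) ∧
    -- pushing a multicausal optimizer through a pointwise minimizer gives a barycenter
    (∀ π ∈ cplMc (fun i => (X i).toFilteredSpace),
      mcCost (infCost fun i => sepCost (c i)) X π =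
        mcValue (infCost fun i => sepCost (c i)) X →
      ∀ φ ∈ minimizers c,
        (∃ ψ, IsBorelVersion X π φ ψ) ∧
        ∀ ψ (hψ : IsBorelVersion X π φ ψ),
          baryFunctional (fun i => sepCost (c i)) X
              (inducedProcess X π ψ fun t => (hψ t).1) =
            baryValue (fun i => sepCost (c i)) X) := by
  choose b hb using hc_bdd
  have hval : baryValue (fun i => sepCost (c i)) X = mcValue (infCost fun i => sepCost (c i)) X :=
    le_antisymm (baryValue_le_mcValue hN hc_meas hb hc_inf)
      (le_iInf fun Y => mcValue_le_baryFunctional hc_meas hb hc_inf Y)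
  refine ⟨hval, fun Ybar hY π hπ => ⟨?_, fun Q hQ => ?_⟩, fun π hπ hopt φ hφ => ⟨?_, fun ψ hψ => ?_⟩⟩
  · exact exists_mem_cplMc_map_eq
      (adjoin (fun i => (X i).toFilteredSpace) Ybar.toFilteredSpace) π fun i => (hπ i).1
  · have hmem := marginalFst_mem_cplMc hQ.1
    refine ⟨hmem, le_antisymm ?_ (iInf₂_le _ hmem)⟩
    -- Optimality of the plans and of `Ybar` closes the chain at the common value.
    calc _ ≤ ∑ i, bcCost (sepCost (c i)) (X i) Ybar (π i) :=
          mcCost_marginalFst_le hc_meas hb hc_inf hQ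
      _ = baryFunctional (fun i => sepCost (c i)) X Ybar :=
          Finset.sum_congr rfl fun i _ => (hπ i).2
      _ = _ := hY.trans hval
  · exact exists_isBorelVersion π fun t => (hφ t).1
  · refine le_antisymm ?_ (iInf_le _ _)
    -- No ε is lost: `φ` attains the infimum at each time, and `ψ` agrees with it along almost every
    -- path.
    refine (baryFunctional_inducedProcess_le hc_meas hb hπ fun t => (hψ t).1).trans ?_
    rw [hval, ← hopt]
    refine expect_mono_ae ?_
    filter_upwards [ae_all_iff.2 fun t => (hψ t).2] with ω hω
    rw [infCost_sepCost hb]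
    refine Finset.sum_le_sum fun t _ => ?_
    rw [hω t]
    exact ((hφ t).2 _).ge
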